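/- Let $p_1=2,\ p_2=3,\ p_3=5,\ldots$ be the sequence of consecutive primes. For an integer $s\ge 2$, let $\mu_s$ denote the least integer such that every integer $\ell>\mu_s$ is the sum of exactly $s$ integers greater than $1$ which are pairwise relatively prime. For every integer $s\ge 2$, if $p_{s+2}-p_{s+1}>1100$, then $\mu_s$ exists and $$\mu_s=\sum_{i=2}^{s+1}p_i+1100.$$ In particular, the set $A$ of integers $s\ge 2$ for which $\mu_s$ exists and $$\mu_s=\sum_{i=2}^{s+1}p_i+1100$$ has asymptotic density $1$, that is, $\lim_{N\to\infty}\#\{s\in A: s\le N\}/N=1$. -/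

import Mathlib

open Filter Topology

/-- The `i`-th prime, counted from one: `prime 1 = 2`, `prime 2 = 3`, `prime 3 = 5`, ...
It is used only for `i ≥ 1`. -/
noncomputable def prime (i : ℕ) : ℕ := Nat.nth Nat.Prime (i - 1)

/-- `ℓ` is the sum of exactly `s` integers greater than `1` that are pairwise relatively prime. -/
def IsCoprimeSum (s : ℕ) (ℓ : ℤ) : Prop :=
  ∃ a : Fin s → ℤ, (∀ i, 1 < a i) ∧ (∀ i j, i ≠ j → IsCoprime (a i) (a j)) ∧ ∑ i, a i = ℓ

/-- The number `μ_s` exists and equals `m`: `m` is the least integer such that every integer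
`ℓ > m` is the sum of exactly `s` integers greater than `1` that are pairwise relatively prime. -/
def IsMu (s : ℕ) (m : ℤ) : Prop :=
  IsLeast {k : ℤ | ∀ ℓ : ℤ, k < ℓ → IsCoprimeSum s ℓ} m

open Classical in
/-- The set `A` of natural numbers has asymptotic density `d`:
`#(A ∩ {1, …, N}) / N` tends to `d` as `N → ∞`. -/
def HasAsymptoticDensity (A : Set ℕ) (d : ℝ) : Prop :=
  Tendsto (fun N : ℕ => (((Finset.Icc 1 N).filter (fun n => n ∈ A)).card : ℝ) / (N : ℝ))
    atTop (𝓝 d)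

/-!
Write `S = p₂ + ⋯ + pₛ₊₁` and suppose that `pₛ₊₂ - pₛ₊₁ > 1100`.

*The number `S + 1100` is not representable.* At most one summand is even, so parity forces all
summands to be odd. Choosing a prime factor of each summand gives `s` distinct odd primes with sum
at most `S + 1100`; the gap leaves only `p₂, …, pₛ₊₁` (`eq_oddPrimes_of_sum_le`). As this holds for
every choice, the summands are powers of these primes (`isGain_of_isCoprimeSum`), and `1100` is not
a sum of increments `p ^ k - p`: only `p ≤ 31` matter, a finite check (`not_isGain_1100`).

*All larger `ℓ` are representable.* The increments `p ^ k - p` of the first `k` odd primes produce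
every even number in `(1100, (k + 1) ^ 3 + 1100]` for `k ≥ 150` (`covers_oddPrimes`): the window is
computed for small primes, and it grows by one prime at a time because Chebyshev's bound
`pₖ₊₁ ^ 2 ≤ k ^ 3` keeps the next increment shorter than the window. This represents all
`ℓ` with `S + 1100 < ℓ ≤ s ^ 3`, by powers of odd primes alone or together with the summand `2`,
according to parity.
For `ℓ > s ^ 3` the summands are `s - 2` larger primes forming a set `Q`, a smaller odd prime `c`,
and the rest `M - c` where `M = ℓ - ∑ Q`. Each `q ∈ Q` divides `M - c` for at most one `c < q`, and
at most `log₂ ℓ` primes `c` divide `M`, so with `s - 1 + log₂ ℓ` candidates some `c` makes the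
summands pairwise coprime (`exists_sub_coprime`); no parity condition is needed.

*Density.* It remains to see that gaps of length at most `1100` are rare. Selberg's sieve, whose
diagonalized quadratic form is in Mathlib, gives `O(x / log² x)` pairs of primes `p`, `p + h` up to
`x` for each fixed `h > 0` (`pairCount_le`). The Selberg sum is bounded from below by
`(∑ 1 / a) ^ 2` over `a ≡ 1` modulo `2 h`, since `g(l)` majorizes the sum of `2 ^ Ω(n) / n` over the
`n` with radical `l`. Compared with Chebyshev's lower bound for the number of primes, this is a
vanishing proportion (`tendsto_card_smallGaps_div`).
-/

/-! ### Sums of powers of given primes -/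

/-- `D` is a *gain* of the finite set `T` if `∑ p ∈ T, p` grows by exactly `D` when every `p ∈ T`
is replaced by some power `p ^ e p` with positive exponent. -/
def IsGain (T : Finset ℕ) (D : ℕ) : Prop :=
  ∃ e : ℕ → ℕ, (∀ p, e p ≠ 0) ∧ ∑ p ∈ T, p ^ e p = ∑ p ∈ T, p + D

lemma IsGain.insert_pow {T : Finset ℕ} {D p : ℕ} (k : ℕ) (h : IsGain T D) (hp : p ∉ T) :
    IsGain (insert p T) (D + (p ^ (k + 1) - p)) := by
  obtain ⟨e, he, hs⟩ := h
  refine ⟨Function.update e p (k + 1), fun q => ?_, ?_⟩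
  · by_cases hq : q = p
    · subst hq; simp
    · simpa [hq] using he q
  · rw [Finset.sum_insert hp, Finset.sum_insert hp, Finset.sum_congr rfl (g := fun q => q ^ e q),
      hs, Function.update_self]
    · have := Nat.le_self_pow (n := k + 1) (by omega) p
      omega
    · intro q hq
      rw [Function.update_of_ne]
      rintro rfl; exact hp hq

lemma IsGain.insert {T : Finset ℕ} {D p : ℕ} (h : IsGain T D) : IsGain (insert p T) D := by
  by_cases hp : p ∈ T
  · rwa [Finset.insert_eq_of_mem hp]
  · simpa using h.insert_pow 0 hp

lemma IsGain.mono {T U : Finset ℕ} {D : ℕ} (h : IsGain T D) (hTU : T ⊆ U) : IsGain U D := by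
  have key : ∀ V : Finset ℕ, IsGain (V ∪ T) D := fun V => by
    induction V using Finset.induction_on with
    | empty => simpa using h
    | insert p V _ ih => rw [Finset.insert_union]; exact ih.insert
  simpa [Finset.union_eq_left.2 hTU] using key U

lemma two_mul_half_pow_sub (p k : ℕ) : 2 * ((p ^ (k + 1) - p) / 2) = p ^ (k + 1) - p := by
  refine Nat.two_mul_div_two_of_even ?_
  rcases Nat.even_or_odd p with h | h
  · exact (Nat.even_sub (Nat.le_self_pow (by omega) p)).2
      (iff_of_true (h.pow_of_ne_zero (by omega)) h)
  · exact Nat.Odd.sub_odd h.pow h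

/-- Half of the increments `p ^ (k + 1) - p` with `k < 8`, as far as they are at most `B`. -/
def halfGains (B p : ℕ) : List ℕ :=
  ((List.range 8).map fun k => (p ^ (k + 1) - p) / 2).filter (· ≤ B)

/-- The set of sums `∑ p ∈ L, g p` with `g p ∈ halfGains B p`, stored as the set of positions of
the binary digits `1` of a natural number. -/
def gainMask (B : ℕ) : List ℕ → ℕ
  | [] => 1
  | p :: L => (halfGains B p).foldr (fun g acc => acc ||| (gainMask B L <<< g)) 0

lemma testBit_foldr_shiftLeft (m D : ℕ) (l : List ℕ) :
    (l.foldr (fun g acc => acc ||| (m <<< g)) 0).testBit D = true ↔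
      ∃ g ∈ l, g ≤ D ∧ m.testBit (D - g) = true := by
  induction l with
  | nil => simp
  | cons g l ih =>
    simp only [List.foldr_cons, Nat.testBit_or, Bool.or_eq_true, ih, Nat.testBit_shiftLeft,
      List.mem_cons, exists_eq_or_imp, Bool.and_eq_true, decide_eq_true_eq, ge_iff_le]
    rw [or_comm]

lemma testBit_gainMask_cons (B p D : ℕ) (L : List ℕ) :
    (gainMask B (p :: L)).testBit D = true ↔
      ∃ k < 8, (p ^ (k + 1) - p) / 2 ≤ B ∧ (p ^ (k + 1) - p) / 2 ≤ D ∧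
        (gainMask B L).testBit (D - (p ^ (k + 1) - p) / 2) = true := by
  rw [gainMask, testBit_foldr_shiftLeft]
  simp [halfGains, and_assoc]

lemma isGain_of_testBit {B : ℕ} {L : List ℕ} (hL : L.Nodup) {D : ℕ}
    (h : (gainMask B L).testBit D = true) : IsGain L.toFinset (2 * D) := by
  induction L generalizing D with
  | nil =>
    have : D = 0 := Nat.testBit_one_eq_true_iff_self_eq_zero.1 h
    exact ⟨fun _ => 1, by simp, by simp [this]⟩
  | cons p L ih =>
    obtain ⟨hp, hL⟩ := List.nodup_cons.1 hL
    obtain ⟨k, -, -, hkD, hk⟩ := (testBit_gainMask_cons B p D L).1 h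
    have := (ih hL hk).insert_pow k (p := p) (by simpa using hp)
    rw [List.toFinset_cons]
    convert this using 1
    have := two_mul_half_pow_sub p k
    omega

/-- The exponents missing from `halfGains` only give increments beyond `B`: `3 ^ 9 - 3 > 6000`. -/
lemma testBit_of_isGain {B : ℕ} (hB : B < 3000) {L : List ℕ} (hL : L.Nodup) (h3 : ∀ p ∈ L, 3 ≤ p)
    {D : ℕ} (hD : D ≤ B) (h : IsGain L.toFinset (2 * D)) : (gainMask B L).testBit D = true := by
  induction L generalizing D with
  | nil =>
    obtain ⟨e, -, he⟩ := h
    have : D = 0 := by simpa using he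
    simp [gainMask, this]
  | cons p L ih =>
    obtain ⟨hp, hL⟩ := List.nodup_cons.1 hL
    obtain ⟨e, he0, he⟩ := h
    rw [List.toFinset_cons, Finset.sum_insert (by simpa using hp),
      Finset.sum_insert (by simpa using hp)] at he
    obtain ⟨k, hk⟩ := Nat.exists_eq_succ_of_ne_zero (he0 p)
    rw [hk, Nat.succ_eq_add_one] at he
    have h1 := two_mul_half_pow_sub p k
    have h2 := Nat.le_self_pow (n := k + 1) (by omega) p
    have h3' : ∑ q ∈ L.toFinset, q ≤ ∑ q ∈ L.toFinset, q ^ e q :=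
      Finset.sum_le_sum fun q _ => Nat.le_self_pow (he0 q) q
    have hk8 : k < 8 := by
      by_contra hk8
      have h4 : p * 3 ^ 8 ≤ p ^ (k + 1) := by
        rw [pow_succ' p k]
        exact Nat.mul_le_mul_left _ ((Nat.pow_le_pow_left (h3 p (by simp)) 8).trans
          (Nat.pow_le_pow_right (by have := h3 p (by simp); omega) (by omega)))
      have := h3 p (by simp)
      omega
    rw [testBit_gainMask_cons]
    refine ⟨k, hk8, by omega, by omega, ih hL (fun q hq => h3 q (by simp [hq])) (by omega)
      ⟨e, he0, by omega⟩⟩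

/-- `T` covers `X` if all even numbers in the window `(1100, X]` are gains of `T`. -/
def Covers (T : Finset ℕ) (X : ℕ) : Prop :=
  ∀ D, 1100 < D → D ≤ X → Even D → IsGain T D

/-- A run of `4879` binary digits `1` starting at position `551`. -/
lemma gainMask_window : gainMask 2500 [3, 5, 7, 11, 13, 17, 19, 23, 29, 31] |||
    ((2 ^ 4879 - 1) <<< 551) = gainMask 2500 [3, 5, 7, 11, 13, 17, 19, 23, 29, 31] := by
  decide +kernel

lemma covers_base : Covers [3, 5, 7, 11, 13, 17, 19, 23, 29, 31].toFinset 10858 := by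
  intro D hD hDX ⟨d, hd⟩
  rw [hd, ← two_mul]
  refine isGain_of_testBit (B := 2500) (by decide) ?_
  rw [← gainMask_window, Nat.testBit_or, Nat.testBit_shiftLeft, Nat.testBit_two_pow_sub_one]
  simp only [Bool.or_eq_true, Bool.and_eq_true, decide_eq_true_eq]
  right; omega

lemma gainMask_1100 :
    (gainMask 2500 [3, 5, 7, 11, 13, 17, 19, 23, 29, 31]).testBit 550 = false := by
  decide +kernel

/-- The exceptional number `1100`: it is not a sum of increments `p ^ k - p` over the odd primes
`p ≤ 31`. -/
lemma not_isGain_1100 : ¬ IsGain [3, 5, 7, 11, 13, 17, 19, 23, 29, 31].toFinset 1100 := fun h => by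
  have := testBit_of_isGain (B := 2500) (by norm_num) (by decide) (by decide) (D := 550)
    (by norm_num) h
  rw [gainMask_1100] at this
  exact absurd this (by decide)

/-- A window longer than the increment of a new prime grows by this increment. -/
lemma Covers.insert_pow {T : Finset ℕ} {X p : ℕ} (k : ℕ) (h : Covers T X) (hp : p ∉ T)
    (hX : p ^ (k + 1) - p + 1100 ≤ X) : Covers (insert p T) (X + (p ^ (k + 1) - p)) := by
  intro D hD hDX hE
  by_cases hDX' : D ≤ X
  · exact (h D hD hDX' hE).insert
  · have hE' : Even (D - (p ^ (k + 1) - p)) := (Nat.even_sub (by omega)).2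
      (iff_of_true hE ⟨_, by rw [← two_mul]; exact (two_mul_half_pow_sub p k).symm⟩)
    convert (h _ (by omega) (by omega) hE').insert_pow k hp using 1
    omega

lemma Covers.mono {T U : Finset ℕ} {X Y : ℕ} (h : Covers T X) (hTU : T ⊆ U) (hYX : Y ≤ X) :
    Covers U Y :=
  fun D hD hDY hE => (h D hD (hDY.trans hYX) hE).mono hTU

/-- Each prime enters with the square or the cube for which `p ^ (k + 1) - p` fits into the window
reached so far; primes below `150` suffice. -/
lemma covers_explicit : Covers ([127, 113, 89, 73, 59, 47, 37, 149, 131, 97, 3, 5, 7, 11, 13, 17,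
    19, 23, 29, 31] : List ℕ).toFinset 4000000 := by
  have h0 := covers_base
  have h1 := h0.insert_pow (p := 97) 1 (by decide) (by norm_num)
  have h2 := h1.insert_pow (p := 131) 1 (by decide) (by norm_num)
  have h3 := h2.insert_pow (p := 149) 1 (by decide) (by norm_num)
  have h4 := h3.insert_pow (p := 37) 2 (by decide) (by norm_num)
  have h5 := h4.insert_pow (p := 47) 2 (by decide) (by norm_num)
  have h6 := h5.insert_pow (p := 59) 2 (by decide) (by norm_num)
  have h7 := h6.insert_pow (p := 73) 2 (by decide) (by norm_num)
  have h8 := h7.insert_pow (p := 89) 2 (by decide) (by norm_num)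
  have h9 := h8.insert_pow (p := 113) 2 (by decide) (by norm_num)
  have h10 := h9.insert_pow (p := 127) 2 (by decide) (by norm_num)
  exact h10.mono (by simp) (by norm_num)

/-! ### The first odd primes -/

lemma prime_prime (i : ℕ) : (prime i).Prime := Nat.prime_nth_prime _

lemma prime_lt_prime {i j : ℕ} (hi : 1 ≤ i) (hij : i < j) : prime i < prime j :=
  Nat.nth_strictMono Nat.infinite_setOfPred_prime (by omega)

lemma prime_le_prime {i j : ℕ} (hij : i ≤ j) : prime i ≤ prime j :=
  Nat.nth_monotone Nat.infinite_setOfPred_prime (by omega)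

lemma lt_of_prime_lt {i j : ℕ} (h : prime i < prime j) : i < j := by
  by_contra hij
  exact absurd (prime_le_prime (not_lt.1 hij)) (by omega)

lemma prime_inj {i j : ℕ} (hi : 1 ≤ i) (hj : 1 ≤ j) (h : prime i = prime j) : i = j := by
  rcases lt_trichotomy i j with h' | h' | h'
  · exact absurd (prime_lt_prime hi h') (by omega)
  · exact h'
  · exact absurd (prime_lt_prime hj h') (by omega)

lemma exists_prime_eq {p : ℕ} (hp : p.Prime) : ∃ i, 1 ≤ i ∧ prime i = p :=
  ⟨Nat.count Nat.Prime p + 1, by omega, by simpa [prime] using Nat.nth_count hp⟩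

lemma prime_one : prime 1 = 2 := Nat.nth_prime_zero_eq_two

lemma two_lt_prime {i : ℕ} (hi : 2 ≤ i) : 2 < prime i := by
  rw [← prime_one]; exact prime_lt_prime le_rfl (by omega)

lemma odd_prime {i : ℕ} (hi : 2 ≤ i) : Odd (prime i) :=
  (prime_prime i).odd_of_ne_two (two_lt_prime hi).ne'

lemma two_mul_add_one_le_prime {i : ℕ} (hi : 1 ≤ i) : 2 * i + 1 ≤ prime (i + 1) := by
  induction i, hi using Nat.le_induction with
  | base => exact two_lt_prime le_rfl
  | succ i hi ih =>
    obtain ⟨a, ha⟩ := odd_prime (i := i + 1) (by omega)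
    obtain ⟨b, hb⟩ := odd_prime (i := i + 1 + 1) (by omega)
    have := prime_lt_prime (i := i + 1) (j := i + 1 + 1) (by omega) (by omega)
    omega

/-- The set `{p₂, …, pₙ₊₁}` of the first `n` odd primes. -/
noncomputable def oddPrimes (n : ℕ) : Finset ℕ := (Finset.Icc 2 (n + 1)).image prime

lemma mem_oddPrimes {n p : ℕ} : p ∈ oddPrimes n ↔ p.Prime ∧ p ≠ 2 ∧ p < prime (n + 2) := by
  simp only [oddPrimes, Finset.mem_image, Finset.mem_Icc]
  constructor
  · rintro ⟨i, ⟨hi, hin⟩, rfl⟩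
    exact ⟨prime_prime i, (two_lt_prime hi).ne', prime_lt_prime (by omega) (by omega)⟩
  · rintro ⟨hp, h2, hlt⟩
    obtain ⟨i, hi, rfl⟩ := exists_prime_eq hp
    have := lt_of_prime_lt hlt
    refine ⟨i, ⟨?_, by omega⟩, rfl⟩
    by_contra hi2
    obtain rfl : i = 1 := by omega
    exact h2 prime_one

lemma prime_injOn (n : ℕ) : Set.InjOn prime (Finset.Icc 2 (n + 1) : Finset ℕ) := by
  intro i hi j hj h
  simp only [Finset.coe_Icc, Set.mem_Icc] at hi hj
  exact prime_inj (by omega) (by omega) h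

lemma card_oddPrimes (n : ℕ) : (oddPrimes n).card = n := by
  rw [oddPrimes, Finset.card_image_of_injOn (prime_injOn n)]
  simp

lemma sum_oddPrimes (n : ℕ) : ∑ p ∈ oddPrimes n, p = ∑ i ∈ Finset.Icc 2 (n + 1), prime i := by
  rw [oddPrimes, Finset.sum_image (prime_injOn n)]

lemma oddPrimes_succ (n : ℕ) : oddPrimes (n + 1) = insert (prime (n + 2)) (oddPrimes n) := by
  rw [oddPrimes, ← Finset.insert_Icc_right_eq_Icc_add_one (by omega), Finset.image_insert]
  rfl

lemma prime_notMem_oddPrimes (n : ℕ) : prime (n + 2) ∉ oddPrimes n := by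
  simp [mem_oddPrimes]

open Real in
/-- The inequality behind the bound `pₖ₊₁ ^ 2 ≤ k ^ 3`, with `t = √k`. -/
lemma chebyshev_cube_bound {t : ℝ} (ht : 12 ≤ t) :
    (t ^ 2 + 1) * (3 * log t) ≤ (t ^ 3 - 1) * log 2 - log (t ^ 3 + 1) := by
  have hl2 := log_two_gt_d9
  have hl2' := log_two_lt_d9
  -- The tangent of `log` at `16`, as `4 * log 2 - 1 < 1.7726`.
  have h1 : log t ≤ t / 16 + 1.7726 := by
    have h := log_le_sub_one_of_pos (show 0 < t / 16 by positivity)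
    rw [log_div (by positivity) (by norm_num), show (16 : ℝ) = 2 ^ 4 by norm_num, log_pow] at h
    push_cast at h
    linarith
  have h2 : log (t ^ 3 + 1) ≤ 3 * log t + 1 := by
    have h : log (t ^ 3 + 1) ≤ log (t ^ 3 * 2) :=
      log_le_log (by positivity) (by nlinarith [pow_le_pow_left₀ (by norm_num) ht 3])
    rw [log_mul (by positivity) (by norm_num), log_pow] at h
    push_cast at h
    linarith
  have h3 : (t ^ 2 + 2) * (3 * log t) ≤ (t ^ 2 + 2) * (3 * (t / 16 + 1.7726)) := by gcongr
  have h4 : (t ^ 3 - 1) * 0.693 ≤ (t ^ 3 - 1) * log 2 :=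
    mul_le_mul_of_nonneg_left (by linarith) (by nlinarith [pow_le_pow_left₀ (by norm_num) ht 3])
  nlinarith [mul_nonneg (sub_nonneg.2 ht) (sq_nonneg t),
    mul_nonneg (sub_nonneg.2 ht) (sub_nonneg.2 ht)]

open Real in
/-- A consequence of Chebyshev's lower bound for the number of primes. -/
lemma prime_succ_sq_le {k : ℕ} (hk : 150 ≤ k) : prime (k + 1) ^ 2 ≤ k ^ 3 := by
  set x := Nat.sqrt (k ^ 3) with hx
  have hxk : x ^ 2 ≤ k ^ 3 := Nat.sqrt_le' _
  have hxk' : k ^ 3 < (x + 1) ^ 2 := Nat.lt_succ_sqrt' _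
  suffices h : k + 1 ≤ Nat.primeCounting x by
    have : prime (k + 1) < x + 1 := Nat.nth_lt_of_lt_count h
    exact (Nat.pow_le_pow_left (by omega) 2).trans hxk
  set t := √(k : ℝ) with ht
  have htk : t ^ 2 = k := sq_sqrt (by positivity)
  have ht0 : 0 ≤ t := sqrt_nonneg _
  have ht12 : 12 ≤ t := by
    rw [ht]; apply le_sqrt_of_sq_le
    have : (150 : ℝ) ≤ k := by exact_mod_cast hk
    linarith
  have hxt : (x : ℝ) ≤ t ^ 3 := by
    refine le_of_sq_le_sq ?_ (by positivity)
    rw [← pow_mul, mul_comm, pow_mul, htk]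
    exact_mod_cast hxk
  have hxt' : t ^ 3 ≤ x + 1 := by
    refine le_of_sq_le_sq ?_ (by positivity)
    rw [← pow_mul, mul_comm, pow_mul, htk]
    exact_mod_cast hxk'.le
  have ht3 : (1000 : ℝ) ≤ t ^ 3 := by nlinarith [pow_le_pow_left₀ (by norm_num) ht12 3]
  have hx1 : (1 : ℝ) < x := by linarith
  have hlogx : 0 < log x := log_pos hx1
  have hb := Chebyshev.pi_ge x
  have hlog : log x ≤ 3 * log t := by
    have := log_le_log (by linarith) hxt
    rwa [log_pow] at this
  have hlog' : log (x + 1) ≤ log (t ^ 3 + 1) := log_le_log (by linarith) (by linarith)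
  have hmain := chebyshev_cube_bound ht12
  have hl2 := log_two_gt_d9
  have : (k : ℝ) + 1 ≤ Nat.primeCounting x := by
    refine le_trans ?_ hb
    rw [le_div_iff₀ hlogx, ← htk]
    have e1 : (t ^ 2 + 1) * log x ≤ (t ^ 2 + 1) * (3 * log t) := by gcongr
    have e2 : (t ^ 3 - 1) * log 2 ≤ x * log 2 := by gcongr; linarith
    linarith
  exact_mod_cast this

/-- In the step `k → k + 1`, the new prime `q` satisfies `2 k + 3 ≤ q` and `q ^ 2 ≤ (k + 1) ^ 3`, so
that its increment `q ^ 2 - q` is long enough for the new window and fits into the old one. -/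
lemma covers_oddPrimes {k : ℕ} (hk : 150 ≤ k) : Covers (oddPrimes k) ((k + 1) ^ 3 + 1100) := by
  induction k, hk using Nat.le_induction with
  | base =>
    refine covers_explicit.mono (fun p hp => ?_) (by norm_num)
    have h1 := two_mul_add_one_le_prime (i := 151) (by norm_num)
    have h2 : ∀ p ∈ [127, 113, 89, 73, 59, 47, 37, 149, 131, 97, 3, 5, 7, 11, 13, 17,
        19, 23, 29, 31], p.Prime ∧ p ≠ 2 ∧ p < 303 := by
      simp only [List.forall_mem_cons]
      norm_num
    obtain ⟨h3, h4, h5⟩ := h2 p (List.mem_toFinset.1 hp)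
    exact mem_oddPrimes.2 ⟨h3, h4, h5.trans_le h1⟩
  | succ k hk ih =>
    have h1 := two_mul_add_one_le_prime (i := k + 1) (by omega)
    have h2 := prime_succ_sq_le (k := k + 1) (by omega)
    rw [oddPrimes_succ]
    have h3 : 4 * k ^ 2 + 10 * k + 6 ≤ prime (k + 2) ^ 2 - prime (k + 2) := by
      rw [Nat.le_sub_iff_add_le (Nat.le_self_pow (by norm_num) _)]
      have h1' : 2 * k + 3 ≤ prime (k + 2) := by
        have : k + 1 + 1 = k + 2 := rfl
        rw [← this]; omega
      nlinarith
    refine (ih.insert_pow 1 (prime_notMem_oddPrimes k) ?_).mono subset_rfl ?_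
    · simp only [Nat.reduceAdd]
      have : k + 1 + 1 = k + 2 := rfl
      rw [this] at h2
      omega
    · simp only [Nat.reduceAdd]
      nlinarith

/-! ### Sums of pairwise coprime integers -/

lemma isCoprimeSum_of_finset {s : ℕ} {T : Finset ℕ} (hT : T.card = s) (f : ℕ → ℤ)
    (h1 : ∀ i ∈ T, 1 < f i) (hf : ∀ i ∈ T, ∀ j ∈ T, i ≠ j → IsCoprime (f i) (f j)) :
    IsCoprimeSum s (∑ i ∈ T, f i) := by
  let e := T.equivFinOfCardEq hT
  refine ⟨fun i => f (e.symm i), fun i => h1 _ (e.symm i).2, fun i j hij => hf _ (e.symm i).2 _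
    (e.symm j).2 fun h => hij (e.symm.injective (Subtype.ext h)), ?_⟩
  rw [e.symm.sum_comp fun x : T => f x, Finset.sum_coe_sort T f]

lemma IsGain.isCoprimeSum {s : ℕ} {T : Finset ℕ} (hT : T.card = s) (hp : ∀ p ∈ T, p.Prime) {D : ℕ}
    (h : IsGain T D) : IsCoprimeSum s ((∑ p ∈ T, p + D : ℕ) : ℤ) := by
  obtain ⟨e, he, hs⟩ := h
  rw [← hs, Nat.cast_sum]
  refine isCoprimeSum_of_finset hT _ (fun p hpT => ?_) fun p hpT q hqT hpq => ?_
  · exact_mod_cast Nat.one_lt_pow (he p) (hp p hpT).one_lt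
  · exact Nat.isCoprime_iff_coprime.2
      (Nat.Coprime.pow _ _ ((Nat.coprime_primes (hp p hpT) (hp q hqT)).2 hpq))

/-- Among sufficiently many primes `c ∈ C` there is one for which `c` and `M - c` are coprime and
`M - c` is divisible by none of the primes in `Q`: each `q ∈ Q` excludes at most one residue class
modulo `q`, and the prime divisors of `M` number at most `log₂ M`. -/
lemma exists_sub_coprime {C Q : Finset ℕ} {M : ℕ} (hC : ∀ c ∈ C, c.Prime)
    (hCQ : ∀ c ∈ C, ∀ q ∈ Q, c < q) (hCM : ∀ c ∈ C, c < M)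
    (hcard : Q.card + Nat.log 2 M < C.card) :
    ∃ c ∈ C, ¬ c ∣ M ∧ ∀ q ∈ Q, ¬ q ∣ M - c := by
  by_contra! hcon
  have hsub : C ⊆ C.filter (· ∣ M) ∪ Q.biUnion fun q => C.filter (q ∣ M - ·) := by
    intro c hc
    by_cases hcM : c ∣ M
    · simp [hc, hcM]
    · obtain ⟨q, hq, hqc⟩ := hcon c hc hcM
      exact Finset.mem_union_right _
        (Finset.mem_biUnion.2 ⟨q, hq, Finset.mem_filter.2 ⟨hc, hqc⟩⟩)
  have hne : C.Nonempty := Finset.card_pos.1 (by omega)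
  obtain ⟨c₀, hc₀⟩ := hne
  have hM : M ≠ 0 := by have := hCM c₀ hc₀; omega
  have h1 : (C.filter (· ∣ M)).card ≤ Nat.log 2 M := by
    refine Nat.le_log_of_pow_le (by norm_num) ?_
    calc 2 ^ (C.filter (· ∣ M)).card ≤ ∏ p ∈ C.filter (· ∣ M), p :=
          Finset.pow_card_le_prod _ _ _ fun p hp => (hC p (Finset.mem_filter.1 hp).1).two_le
      _ ≤ M := Nat.le_of_dvd (Nat.pos_of_ne_zero hM) ?_
    refine Finset.prod_primes_dvd _ (fun p hp => (hC p (Finset.mem_filter.1 hp).1).prime)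
      fun p hp => (Finset.mem_filter.1 hp).2
  have h2 : (Q.biUnion fun q => C.filter (q ∣ M - ·)).card ≤ Q.card * 1 := by
    refine Finset.card_biUnion_le_card_mul _ _ _ fun q hq => Finset.card_le_one.2 ?_
    intro a ha b hb
    obtain ⟨haC, ha⟩ := Finset.mem_filter.1 ha
    obtain ⟨hbC, hb⟩ := Finset.mem_filter.1 hb
    have h3 : a ≡ b [MOD q] := by
      have ha' := (Nat.modEq_iff_dvd' (hCM a haC).le).2 ha
      have hb' := (Nat.modEq_iff_dvd' (hCM b hbC).le).2 hb
      exact ha'.trans hb'.symm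
    exact Nat.ModEq.eq_of_lt_of_lt h3 (hCQ a haC q hq) (hCQ b hbC q hq)
  have := Finset.card_le_card hsub
  have := Finset.card_union_le (C.filter (· ∣ M)) (Q.biUnion fun q => C.filter (q ∣ M - ·))
  omega

lemma eight_mul_pow_five_le {m : ℕ} (hm : 20 ≤ m) : 8 * m ^ 5 ≤ 4 ^ m := by
  induction m, hm using Nat.le_induction with
  | base => norm_num
  | succ m hm ih =>
    have h : (20 * (m + 1)) ^ 5 ≤ (21 * m) ^ 5 := Nat.pow_le_pow_left (by omega) 5
    rw [mul_pow, mul_pow] at h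
    rw [pow_succ 4 m]
    omega

/-- The size estimate that leaves room for a free summand: `s` primes among the first
`2 s + log₂ ℓ` ones have sum at most `ℓ`. -/
lemma mul_prime_le {s ℓ : ℕ} (hs : 150 ≤ s) (hℓ : s ^ 3 < ℓ) :
    s * prime (2 * s + Nat.log 2 ℓ + 1) ≤ ℓ := by
  set m := Nat.log 2 ℓ with hm
  have h2m : 2 ^ m ≤ ℓ := Nat.pow_log_le_self 2 (by omega)
  have h := prime_succ_sq_le (k := 2 * s + m) (by omega)
  refine (Nat.pow_le_pow_iff_left (n := 2) (by norm_num)).1 ?_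
  rw [mul_pow]
  rcases le_or_gt m (2 * s) with hms | hms
  · calc s ^ 2 * prime (2 * s + m + 1) ^ 2 ≤ s ^ 2 * (2 * s + 2 * s) ^ 3 := by
          exact Nat.mul_le_mul_left _ (h.trans (Nat.pow_le_pow_left (by omega) 3))
      _ = s ^ 5 * 64 := by ring
      _ ≤ s ^ 5 * s := by gcongr; omega
      _ = (s ^ 3) ^ 2 := by ring
      _ ≤ ℓ ^ 2 := by gcongr
  · calc s ^ 2 * prime (2 * s + m + 1) ^ 2 ≤ m ^ 2 * (m + m) ^ 3 := by
          exact Nat.mul_le_mul (Nat.pow_le_pow_left (by omega) 2)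
            (h.trans (Nat.pow_le_pow_left (by omega) 3))
      _ = 8 * m ^ 5 := by ring
      _ ≤ 4 ^ m := eight_mul_pow_five_le (by omega)
      _ = (2 ^ m) ^ 2 := by rw [← pow_mul, mul_comm, pow_mul]; norm_num
      _ ≤ ℓ ^ 2 := by gcongr

/-- For large `ℓ` the summands are `s - 2` primes, a smaller odd prime `c`, and the rest `b`. -/
lemma isCoprimeSum_of_cube_lt {s ℓ : ℕ} (hs : 150 ≤ s) (hℓ : s ^ 3 < ℓ) :
    IsCoprimeSum s (ℓ : ℤ) := by
  set n := s - 1 + Nat.log 2 ℓ with hn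
  set Q : Finset ℕ := (Finset.Icc (n + 2) (n + s - 1)).image prime with hQ
  have hQprime : ∀ q ∈ Q, q.Prime ∧ 2 < q ∧ q ≤ prime (n + s - 1) := by
    intro q hq
    obtain ⟨i, hi, rfl⟩ := Finset.mem_image.1 hq
    rw [Finset.mem_Icc] at hi
    exact ⟨prime_prime i, two_lt_prime (by omega), prime_le_prime hi.2⟩
  have hQcard : Q.card = s - 2 := by
    rw [hQ, Finset.card_image_of_injOn, Nat.card_Icc]
    · omega
    · intro i hi j hj h
      simp only [Finset.coe_Icc, Set.mem_Icc] at hi hj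
      exact prime_inj (by omega) (by omega) h
  have hCQ : ∀ c ∈ oddPrimes n, ∀ q ∈ Q, c < q := by
    intro c hc q hq
    obtain ⟨i, hi, rfl⟩ := Finset.mem_image.1 hq
    rw [Finset.mem_Icc] at hi
    exact (mem_oddPrimes.1 hc).2.2.trans_le (prime_le_prime hi.1)
  have hP := mul_prime_le hs hℓ
  have hPle : prime (n + s - 1) ≤ prime (2 * s + Nat.log 2 ℓ + 1) := prime_le_prime (by omega)
  set P := prime (2 * s + Nat.log 2 ℓ + 1)
  have hP2 : 2 < P := two_lt_prime (by omega)
  have hsum : ∑ q ∈ Q, q ≤ (s - 2) * P := by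
    rw [← hQcard, ← smul_eq_mul]
    exact Finset.sum_le_card_nsmul _ _ _ fun q hq => (hQprime q hq).2.2.trans hPle
  have hsP : (s - 2) * P + P + P = s * P := by
    obtain ⟨r, rfl⟩ : ∃ r, s = r + 2 := ⟨s - 2, by omega⟩
    simp; ring
  have hCP : ∀ c ∈ oddPrimes n, c < P := fun c hc =>
    (mem_oddPrimes.1 hc).2.2.trans_le (prime_le_prime (by omega))
  obtain ⟨c, hc, hcM, hcQ⟩ := exists_sub_coprime (C := oddPrimes n) (Q := Q)
    (M := ℓ - ∑ q ∈ Q, q) (fun c hc => (mem_oddPrimes.1 hc).1) hCQ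
    (fun c hc => by have := hCP c hc; omega) (by
      rw [hQcard, card_oddPrimes]
      have := Nat.log_mono_right (b := 2) (Nat.sub_le ℓ (∑ q ∈ Q, q))
      omega)
  have hcp := (mem_oddPrimes.1 hc).1
  have hcP := hCP c hc
  set b := ℓ - ∑ q ∈ Q, q - c with hb
  have hcb : ¬ c ∣ b := fun h => hcM (by
    have := (Nat.dvd_add_right h).2 (dvd_refl c)
    rwa [hb, Nat.sub_add_cancel (by omega)] at this)
  -- The index `0` stands for the free summand `b`, every other index for itself.
  have h0 : 0 ∉ insert c Q := by
    simp only [Finset.mem_insert, not_or]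
    exact ⟨hcp.ne_zero.symm, fun h => (hQprime 0 h).1.ne_zero rfl⟩
  have hcQ' : c ∉ Q := fun h => absurd (hCQ c hc c h) (lt_irrefl c)
  have hprime : ∀ q ∈ insert c Q, q.Prime ∧ ¬ q ∣ b := by
    intro q hq
    rcases Finset.mem_insert.1 hq with rfl | hq
    · exact ⟨hcp, hcb⟩
    · exact ⟨(hQprime q hq).1, hcQ q hq⟩
  have hne : ∀ q ∈ insert c Q, q ≠ 0 := fun q hq => (hprime q hq).1.ne_zero
  have hres := isCoprimeSum_of_finset (s := s) (T := insert 0 (insert c Q))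
    (by rw [Finset.card_insert_of_notMem h0, Finset.card_insert_of_notMem hcQ', hQcard]; omega)
    (fun i => if i = 0 then (b : ℤ) else i) ?_ ?_
  · convert hres using 1
    rw [Finset.sum_insert h0, Finset.sum_congr rfl
      (g := fun i : ℕ => (i : ℤ)) (fun q hq => if_neg (hne q hq)), Finset.sum_insert hcQ',
      ← Nat.cast_sum, if_pos rfl]
    norm_cast
    omega
  · intro i hi
    rcases Finset.mem_insert.1 hi with rfl | hi
    · rw [if_pos rfl]; norm_cast; omega
    · rw [if_neg (hne i hi)]; exact_mod_cast (hprime i hi).1.one_lt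
  · intro i hi j hj hij
    rcases Finset.mem_insert.1 hi with rfl | hi <;> rcases Finset.mem_insert.1 hj with rfl | hj
    · exact absurd rfl hij
    · rw [if_pos rfl, if_neg (hne j hj)]
      exact (Nat.isCoprime_iff_coprime.2
        (((hprime j hj).1.coprime_iff_not_dvd).2 (hprime j hj).2)).symm
    · rw [if_pos rfl, if_neg (hne i hi)]
      exact Nat.isCoprime_iff_coprime.2
        (((hprime i hi).1.coprime_iff_not_dvd).2 (hprime i hi).2)
    · rw [if_neg (hne i hi), if_neg (hne j hj)]
      exact Nat.isCoprime_iff_coprime.2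
        ((Nat.coprime_primes (hprime i hi).1 (hprime j hj).1).2 hij)

/-- A prime gap exceeding `1100` lies beyond `1999`, as `2`, `1097` and `1999` are primes, while the
`151`st prime is at most `√(150 ^ 3) < 1999`. -/
lemma lt_of_gap {s : ℕ} (h : 1100 + prime (s + 1) < prime (s + 2)) : 150 < s := by
  have key : ∀ p, p.Prime → p < prime (s + 2) → p ≤ prime (s + 1) := by
    intro p hp hlt
    obtain ⟨i, -, rfl⟩ := exists_prime_eq hp
    have := lt_of_prime_lt hlt
    exact prime_le_prime (by omega)
  have h1 := key 1097 (by norm_num) (by omega)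
  have h2 := key 1999 (by norm_num) (by omega)
  by_contra hs
  have h3 : prime (s + 1) ≤ prime (150 + 1) := prime_le_prime (by omega)
  have h4 := prime_succ_sq_le (k := 150) le_rfl
  nlinarith

/-- Representability of all `ℓ > p₂ + ⋯ + pₛ₊₁ + 1100`. -/
lemma isCoprimeSum_of_lt {s ℓ : ℕ} (hs : 150 < s) (hℓ : ∑ p ∈ oddPrimes s, p + 1100 < ℓ) :
    IsCoprimeSum s (ℓ : ℤ) := by
  rcases lt_or_ge (s ^ 3) ℓ with h | h
  · exact isCoprimeSum_of_cube_lt hs.le h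
  have hodd : ∀ n, ∀ p ∈ oddPrimes n, p.Prime := fun n p hp => (mem_oddPrimes.1 hp).1
  rcases Nat.even_or_odd (ℓ - ∑ p ∈ oddPrimes s, p) with hE | hO
  · have h3 : s ^ 3 ≤ (s + 1) ^ 3 := Nat.pow_le_pow_left (by omega) 3
    have := (covers_oddPrimes hs.le _ (by omega) (by omega) hE).isCoprimeSum (card_oddPrimes s)
      (hodd s)
    rwa [Nat.add_sub_cancel' (by omega)] at this
  · -- Of the wrong parity: `2` takes the place of the largest of the odd primes.
    obtain ⟨r, rfl⟩ : ∃ r, s = r + 1 := ⟨s - 1, by omega⟩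
    have h2 : 2 ∉ oddPrimes r := fun h => (mem_oddPrimes.1 h).2.1 rfl
    have hp := odd_prime (i := r + 2) (by omega)
    have hp2 := two_lt_prime (i := r + 2) (by omega)
    rw [oddPrimes_succ, Finset.sum_insert (prime_notMem_oddPrimes r)] at hO hℓ
    have hE : Even (ℓ - (2 + ∑ p ∈ oddPrimes r, p)) := by
      obtain ⟨x, hx⟩ := hO
      obtain ⟨y, hy⟩ := hp
      exact ⟨x + y, by omega⟩
    have hg := (covers_oddPrimes (k := r) (by omega) _ (by omega) (by omega) hE).insert (p := 2)
    have := hg.isCoprimeSum (s := r + 1)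
      (by rw [Finset.card_insert_of_notMem h2, card_oddPrimes]) (fun p hp => by
        rcases Finset.mem_insert.1 hp with rfl | hp
        · exact Nat.prime_two
        · exact hodd r p hp)
    rwa [Finset.sum_insert h2, Nat.add_sub_cancel' (by omega)] at this

/-- Replacing `k` of the first `s` odd primes by others raises the sum by at least `k` times the
length of the gap. -/
lemma eq_oddPrimes_of_sum_le {s : ℕ} (hgap : 1100 + prime (s + 1) < prime (s + 2)) {F : Finset ℕ}
    (hF : ∀ p ∈ F, p.Prime ∧ p ≠ 2) (hcard : F.card = s)
    (hsum : ∑ p ∈ F, p ≤ ∑ p ∈ oddPrimes s, p + 1100) : F = oddPrimes s := by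
  have hc : (F \ oddPrimes s).card = (oddPrimes s \ F).card :=
    (Finset.card_sdiff_comm (by rw [hcard, card_oddPrimes]))
  by_contra hne
  have hpos : (F \ oddPrimes s).card ≠ 0 := by
    intro h0
    exact hne (Finset.eq_of_subset_of_card_le (Finset.sdiff_eq_empty_iff_subset.1
      (Finset.card_eq_zero.1 h0)) (by rw [hcard, card_oddPrimes]))
  have h1 : (F \ oddPrimes s).card * prime (s + 2) ≤ ∑ p ∈ F \ oddPrimes s, p := by
    rw [← smul_eq_mul]
    refine Finset.card_nsmul_le_sum _ _ _ fun p hp => ?_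
    obtain ⟨hpF, hpo⟩ := Finset.mem_sdiff.1 hp
    by_contra hlt
    exact hpo (mem_oddPrimes.2 ⟨(hF p hpF).1, (hF p hpF).2, not_le.1 hlt⟩)
  have h2 : ∑ p ∈ oddPrimes s \ F, p ≤ (oddPrimes s \ F).card * prime (s + 1) := by
    rw [← smul_eq_mul]
    refine Finset.sum_le_card_nsmul _ _ _ fun p hp => ?_
    obtain ⟨i, hi, rfl⟩ := Finset.mem_image.1 (Finset.mem_sdiff.1 hp).1
    exact prime_le_prime (Finset.mem_Icc.1 hi).2
  have h3 := Finset.sum_inter_add_sum_sdiff F (oddPrimes s) (fun p => p)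
  have h4 := Finset.sum_inter_add_sum_sdiff (oddPrimes s) F (fun p => p)
  rw [Finset.inter_comm] at h4
  rw [← hc] at h2
  set k := (F \ oddPrimes s).card
  have h5 : k * prime (s + 1) + 1101 ≤ k * prime (s + 2) := by
    have : 1 ≤ k := Nat.pos_of_ne_zero hpos
    nlinarith
  omega

/-- Numbers `p` with `p ^ 2 - p > D` cannot contribute to the gain `D`. -/
lemma IsGain.of_subset {T U : Finset ℕ} {D : ℕ} (h : IsGain U D) (hTU : T ⊆ U)
    (hp : ∀ p ∈ U, p ∉ T → 0 < p ∧ p + D < p ^ 2) : IsGain T D := by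
  obtain ⟨e, he, hs⟩ := h
  refine ⟨e, he, ?_⟩
  have hle : ∀ q, q ≤ q ^ e q := fun q => Nat.le_self_pow (he q) q
  have h1 : ∑ p ∈ U \ T, p ^ e p = ∑ p ∈ U \ T, p := by
    refine Finset.sum_congr rfl fun p hpU => ?_
    obtain ⟨hpU, hpT⟩ := Finset.mem_sdiff.1 hpU
    obtain ⟨hp0, hpD⟩ := hp p hpU hpT
    have h2 : p ^ e p ≤ p + D := by
      have := Finset.sum_erase_add U (fun q => q ^ e q) hpU
      have := Finset.sum_erase_add U (fun q => q) hpU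
      have : ∑ q ∈ U.erase p, q ≤ ∑ q ∈ U.erase p, q ^ e q := Finset.sum_le_sum fun q _ => hle q
      omega
    have h3 : e p < 2 := by
      by_contra h3
      have := Nat.pow_le_pow_right hp0 (not_lt.1 h3)
      omega
    have h4 : e p = 1 := by have := he p; omega
    rw [h4, pow_one]
  have h2 := Finset.sum_sdiff hTU (f := fun p => p ^ e p)
  have h3 := Finset.sum_sdiff hTU (f := fun p => p)
  omega

/-- Two even summands are not coprime, and exactly one would give the sum the wrong parity. -/
lemma odd_of_sum_eq {s : ℕ} {b : Fin s → ℕ} (hb : ∀ i j, i ≠ j → (b i).Coprime (b j))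
    (hsum : ∑ i, b i = ∑ p ∈ oddPrimes s, p + 1100) (i : Fin s) : Odd (b i) := by
  by_contra hi
  rw [Nat.not_odd_iff_even] at hi
  have h1 : (Finset.univ.filter fun j => Odd (b j)) = Finset.univ.erase i := by
    ext j
    simp only [Finset.mem_filter, Finset.mem_univ, true_and, Finset.mem_erase, and_true]
    constructor
    · rintro hj rfl
      exact (Nat.not_odd_iff_even.2 hi) hj
    · intro hji
      by_contra hj
      rw [Nat.not_odd_iff_even] at hj
      have := Nat.dvd_gcd hi.two_dvd hj.two_dvd
      rw [hb i j (Ne.symm hji)] at this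
      omega
  have h2 : ((oddPrimes s).filter fun p => Odd p) = oddPrimes s := by
    refine Finset.filter_true_of_mem fun p hp => ?_
    obtain ⟨hp, hp2, -⟩ := mem_oddPrimes.1 hp
    exact hp.odd_of_ne_two hp2
  have h3 := Finset.even_sum_iff_even_card_odd (s := Finset.univ) b
  have h4 := Finset.even_sum_iff_even_card_odd (s := oddPrimes s) (fun p => p)
  rw [h1, hsum, Finset.card_erase_of_mem (Finset.mem_univ i), Finset.card_univ,
    Fintype.card_fin] at h3
  rw [h2, card_oddPrimes] at h4
  have := i.2
  grind

/-- Across a prime gap exceeding `1100`, the number `p₂ + ⋯ + pₛ₊₁ + 1100` could only be a sum of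
powers of the primes `p₂, …, pₛ₊₁`. -/
lemma isGain_of_isCoprimeSum {s : ℕ} (hgap : 1100 + prime (s + 1) < prime (s + 2))
    (h : IsCoprimeSum s ((∑ p ∈ oddPrimes s, p + 1100 : ℕ) : ℤ)) : IsGain (oddPrimes s) 1100 := by
  obtain ⟨a, ha1, hac, hsum⟩ := h
  lift a to Fin s → ℕ using fun i => by have := ha1 i; omega
  simp only [Nat.one_lt_cast] at ha1
  have hc : ∀ i j, i ≠ j → (a i).Coprime (a j) := fun i j hij =>
    Nat.isCoprime_iff_coprime.1 (hac i j hij)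
  have hsum' : ∑ i, a i = ∑ p ∈ oddPrimes s, p + 1100 := by
    rw [← Nat.cast_sum] at hsum
    exact_mod_cast hsum
  have hodd := odd_of_sum_eq hc hsum'
  -- Every choice of one prime factor per summand gives the first `s` odd primes. Comparing two
  -- choices that differ at one index shows that each summand has only one prime factor.
  have key : ∀ r : Fin s → ℕ, (∀ i, (r i).Prime ∧ r i ∣ a i) →
      r.Injective ∧ Finset.univ.image r = oddPrimes s := by
    intro r hr
    have hinj : r.Injective := by
      intro i j hij
      by_contra hne
      have h1 := Nat.dvd_gcd (hr i).2 (hij ▸ (hr j).2)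
      rw [hc i j hne] at h1
      exact (hr i).1.one_lt.ne' (Nat.dvd_one.1 h1)
    refine ⟨hinj, eq_oddPrimes_of_sum_le hgap ?_ ?_ ?_⟩
    · intro p hp
      obtain ⟨i, -, rfl⟩ := Finset.mem_image.1 hp
      refine ⟨(hr i).1, fun h2 => ?_⟩
      have := (hodd i).of_dvd_nat (hr i).2
      rw [h2] at this
      exact absurd this (by decide)
    · rw [Finset.card_image_of_injective _ hinj, Finset.card_univ, Fintype.card_fin]
    · rw [Finset.sum_image fun _ _ _ _ h => hinj h, ← hsum']
      exact Finset.sum_le_sum fun i _ =>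
        Nat.le_of_dvd (by have := ha1 i; omega) (hr i).2
  set r : Fin s → ℕ := fun i => (a i).minFac with hr
  have hrp : ∀ i, (r i).Prime ∧ r i ∣ a i := fun i =>
    ⟨Nat.minFac_prime (ha1 i).ne', Nat.minFac_dvd _⟩
  obtain ⟨hinj, himg⟩ := key r hrp
  have huniq : ∀ i, ∀ {q : ℕ}, q.Prime → q ∣ a i → q = r i := by
    intro i q hq hqi
    have h1 := (key (Function.update r i q) fun j => by
      by_cases hj : j = i
      · subst hj; simpa using ⟨hq, hqi⟩
      · simpa [hj] using hrp j).2
    have h2 : q ∈ Finset.univ.image r := by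
      rw [himg, ← h1]
      exact Finset.mem_image.2 ⟨i, Finset.mem_univ i, by simp⟩
    obtain ⟨j, -, hj⟩ := Finset.mem_image.1 h2
    by_contra hne
    have hij : i ≠ j := by rintro rfl; exact hne hj.symm
    have h3 := Nat.dvd_gcd hqi (hj ▸ (hrp j).2)
    rw [hc i j hij] at h3
    exact hq.one_lt.ne' (Nat.dvd_one.1 h3)
  have hpow : ∀ i, a i = r i ^ (a i).primeFactorsList.length := fun i =>
    Nat.eq_prime_pow_of_unique_prime_dvd (by have := ha1 i; omega) (huniq i)
  refine ⟨Function.extend r (fun i => (a i).primeFactorsList.length) 1, fun p => ?_, ?_⟩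
  · by_cases hp : ∃ i, r i = p
    · obtain ⟨i, rfl⟩ := hp
      rw [hinj.extend_apply]
      intro h0
      have h1 := hpow i
      rw [h0, pow_zero] at h1
      exact (ha1 i).ne' h1
    · rw [Function.extend_apply' _ _ _ hp]; simp
  · rw [← hsum', ← himg, Finset.sum_image fun _ _ _ _ h => hinj h]
    refine Finset.sum_congr rfl fun i _ => ?_
    rw [hinj.extend_apply, ← hpow i]

lemma isMu_of_gap {s : ℕ} (hgap : 1100 + prime (s + 1) < prime (s + 2)) :
    IsMu s ((∑ i ∈ Finset.Icc 2 (s + 1), (prime i : ℤ)) + 1100) := by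
  have hs := lt_of_gap hgap
  have hcast : (∑ i ∈ Finset.Icc 2 (s + 1), (prime i : ℤ)) + 1100 =
      ((∑ p ∈ oddPrimes s, p + 1100 : ℕ) : ℤ) := by
    rw [sum_oddPrimes]; push_cast; rfl
  rw [hcast]
  constructor
  · intro ℓ hℓ
    lift ℓ to ℕ using by omega
    exact isCoprimeSum_of_lt hs (by exact_mod_cast hℓ)
  · intro k hk
    by_contra hlt
    refine not_isGain_1100 ((isGain_of_isCoprimeSum hgap (hk _ (not_le.1 hlt))).of_subset ?_ ?_)
    · have h1 := two_mul_add_one_le_prime (i := s + 1) (by omega)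
      have h2 : ∀ p ∈ [3, 5, 7, 11, 13, 17, 19, 23, 29, 31], p.Prime ∧ p ≠ 2 ∧ p < 300 := by
        simp only [List.forall_mem_cons]
        norm_num
      intro p hp
      obtain ⟨h3, h4, h5⟩ := h2 p (List.mem_toFinset.1 hp)
      exact mem_oddPrimes.2 ⟨h3, h4, h5.trans_le (by omega)⟩
    · intro p hp hpT
      obtain ⟨hp, hp2, -⟩ := mem_oddPrimes.1 hp
      refine ⟨hp.pos, ?_⟩
      have h34 : 34 ≤ p := by
        by_contra h34
        have : p < 34 := by omega
        interval_cases p <;> revert hp hp2 hpT <;> decide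
      nlinarith

/-! ### Selberg's upper bound sieve -/

namespace BoundingSieve

open ArithmeticFunction Nat
open scoped ArithmeticFunction.Moebius

variable {s : BoundingSieve}

/-- The sum `∑ g(l)` over the divisors `l ≤ z` of the sifting product, where `g = ν / (1 - ν)` on
primes; Selberg's main term is its reciprocal. -/
noncomputable def selbergSum (s : BoundingSieve) (z : ℕ) : ℝ :=
  ∑ l ∈ s.prodPrimes.divisors with l ≤ z, s.selbergTerms l

/-- Selberg's weights of level `z`, which minimize the main term. -/
noncomputable def selbergWeights (s : BoundingSieve) (z d : ℕ) : ℝ :=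
  (s.nu d)⁻¹ * (s.selbergSum z)⁻¹ * μ d *
    ∑ l ∈ s.prodPrimes.divisors with l ≤ z ∧ d ∣ l, s.selbergTerms l

lemma selbergSum_pos {z : ℕ} (hz : 1 ≤ z) : 0 < s.selbergSum z := by
  refine Finset.sum_pos (fun l hl => selbergTerms_pos ?_) ⟨1, ?_⟩
  · exact dvd_of_mem_divisors (Finset.mem_filter.1 hl).1
  · simp [hz, prodPrimes_ne_zero]

lemma selbergWeights_one {z : ℕ} (hz : 1 ≤ z) : s.selbergWeights z 1 = 1 := by
  have := (selbergSum_pos (s := s) hz).ne'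
  simp [selbergWeights, s.nu_mult.map_one, selbergSum] at this ⊢
  exact inv_mul_cancel₀ this

lemma selbergWeights_eq_zero {z d : ℕ} (hzd : z < d) : s.selbergWeights z d = 0 := by
  rw [selbergWeights, Finset.filter_false_of_mem, Finset.sum_empty, mul_zero]
  rintro l hl ⟨hlz, hdl⟩
  exact absurd (Nat.le_of_dvd (Nat.pos_of_mem_divisors hl) hdl) (by omega)

lemma abs_selbergWeights_le {z d : ℕ} (hz : 1 ≤ z) (hd : d ∣ s.prodPrimes) :
    |s.selbergWeights z d| ≤ (s.nu d)⁻¹ := by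
  have hG := selbergSum_pos (s := s) hz
  have hν := nu_pos_of_dvd_prodPrimes hd
  have hg : ∀ l ∈ s.prodPrimes.divisors, 0 ≤ s.selbergTerms l := fun l hl =>
    (selbergTerms_pos (dvd_of_mem_divisors hl)).le
  have h0 : 0 ≤ ∑ l ∈ s.prodPrimes.divisors with l ≤ z ∧ d ∣ l, s.selbergTerms l :=
    Finset.sum_nonneg fun l hl => hg l (Finset.mem_filter.1 hl).1
  have h1 : ∑ l ∈ s.prodPrimes.divisors with l ≤ z ∧ d ∣ l, s.selbergTerms l ≤ s.selbergSum z := by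
    refine Finset.sum_le_sum_of_subset_of_nonneg (fun l hl => ?_) fun l hl _ =>
      hg l (Finset.mem_filter.1 hl).1
    simp only [Finset.mem_filter] at hl ⊢
    exact ⟨hl.1, hl.2.1⟩
  have h2 : |(μ d : ℝ)| ≤ 1 := by exact_mod_cast abs_moebius_le_one
  rw [selbergWeights, abs_mul, abs_mul, abs_mul, abs_of_pos (inv_pos.2 hν),
    abs_of_pos (inv_pos.2 hG), abs_of_nonneg h0]
  calc (s.nu d)⁻¹ * (s.selbergSum z)⁻¹ * |(μ d : ℝ)| *
        ∑ l ∈ s.prodPrimes.divisors with l ≤ z ∧ d ∣ l, s.selbergTerms l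
      ≤ (s.nu d)⁻¹ * (s.selbergSum z)⁻¹ * 1 * s.selbergSum z := by gcongr
    _ = (s.nu d)⁻¹ := by field_simp

lemma sum_moebius_between {l m : ℕ} (hm : Squarefree m) (hlm : l ∣ m) :
    ∑ d ∈ m.divisors with l ∣ d, (μ d : ℝ) = if m = l then (μ l : ℝ) else 0 := by
  obtain ⟨k, rfl⟩ := hlm
  obtain ⟨hlk, -, -⟩ := Nat.squarefree_mul_iff.1 hm
  have hl0 : l ≠ 0 := by rintro rfl; simp at hm
  have hk0 : k ≠ 0 := by rintro rfl; simp at hm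
  have himg : (l * k).divisors.filter (l ∣ ·) = k.divisors.image (l * ·) := by
    ext d
    simp only [Finset.mem_filter, Nat.mem_divisors, Finset.mem_image]
    constructor
    · rintro ⟨⟨hd, -⟩, e, rfl⟩
      exact ⟨e, ⟨Nat.dvd_of_mul_dvd_mul_left (Nat.pos_of_ne_zero hl0) hd, hk0⟩, rfl⟩
    · rintro ⟨e, ⟨he, -⟩, rfl⟩
      exact ⟨⟨Nat.mul_dvd_mul_left l he, mul_ne_zero hl0 hk0⟩, dvd_mul_right l e⟩
  have h1 : ∑ d ∈ k.divisors, (μ d : ℝ) = if k = 1 then 1 else 0 := by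
    have := congr_arg (fun f : ArithmeticFunction ℤ => f k) moebius_mul_coe_zeta
    simp only [one_apply, coe_mul_zeta_apply] at this
    exact_mod_cast this
  rw [himg, Finset.sum_image fun a _ b _ h => Nat.eq_of_mul_eq_mul_left (Nat.pos_of_ne_zero hl0) h]
  have h2 : ∀ e ∈ k.divisors, (μ (l * e) : ℝ) = μ l * μ e := by
    intro e he
    rw [isMultiplicative_moebius.map_mul_of_coprime
      (hlk.coprime_dvd_right (dvd_of_mem_divisors he))]
    push_cast; rfl
  rw [Finset.sum_congr rfl h2, ← Finset.mul_sum, h1]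
  have : l * k = l ↔ k = 1 := by
    constructor
    · intro h
      exact Nat.eq_of_mul_eq_mul_left (Nat.pos_of_ne_zero hl0) (by rw [h, mul_one])
    · rintro rfl; exact mul_one l
  simp only [this, mul_ite, mul_one, mul_zero]

/-- The weights diagonalize the quadratic form: Möbius inversion leaves only the term `m = l`. -/
lemma sum_nu_mul_selbergWeights {z l : ℕ} (hl : l ∣ s.prodPrimes) :
    (∑ d ∈ s.prodPrimes.divisors, if l ∣ d then s.nu d * s.selbergWeights z d else 0) =
      if l ≤ z then (s.selbergSum z)⁻¹ * (s.selbergTerms l * μ l) else 0 := by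
  have h1 : ∀ d ∈ s.prodPrimes.divisors, (if l ∣ d then s.nu d * s.selbergWeights z d else 0) =
      ∑ m ∈ s.prodPrimes.divisors with m ≤ z, (s.selbergSum z)⁻¹ * (s.selbergTerms m *
        if d ∣ m ∧ l ∣ d then (μ d : ℝ) else 0) := by
    intro d hd
    have hν := (nu_pos_of_dvd_prodPrimes (dvd_of_mem_divisors hd)).ne'
    by_cases hld : l ∣ d
    · simp only [hld, if_true, and_true, selbergWeights, ← Finset.filter_filter]
      rw [Finset.sum_filter (p := fun l => d ∣ l), Finset.mul_sum, Finset.mul_sum]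
      refine Finset.sum_congr rfl fun m _ => ?_
      by_cases hdm : d ∣ m
      · simp only [hdm, if_true]; field_simp
      · simp [hdm]
    · simp [hld]
  rw [Finset.sum_congr rfl h1, Finset.sum_comm]
  have h2 : ∀ m ∈ s.prodPrimes.divisors.filter (· ≤ z),
      ∑ d ∈ s.prodPrimes.divisors, (s.selbergSum z)⁻¹ * (s.selbergTerms m *
        if d ∣ m ∧ l ∣ d then (μ d : ℝ) else 0) =
      if m = l then (s.selbergSum z)⁻¹ * (s.selbergTerms l * μ l) else 0 := by
    intro m hm
    have hmP := dvd_of_mem_divisors (Finset.mem_filter.1 hm).1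
    rw [← Finset.mul_sum, ← Finset.mul_sum, ← Finset.sum_filter, ← Finset.filter_filter,
      Nat.divisors_filter_dvd_of_dvd prodPrimes_ne_zero hmP]
    by_cases hlm : l ∣ m
    · rw [sum_moebius_between (squarefree_of_dvd_prodPrimes hmP) hlm]
      by_cases h : m = l
      · simp [h]
      · simp [h]
    · rw [Finset.filter_false_of_mem, Finset.sum_empty]
      · have : m ≠ l := by rintro rfl; exact hlm dvd_rfl
        simp [this]
      · intro d hd hld
        exact hlm (hld.trans (dvd_of_mem_divisors hd))
  rw [Finset.sum_congr rfl h2, Finset.sum_ite_eq']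
  simp [hl, prodPrimes_ne_zero]

lemma mainSum_selbergWeights {z : ℕ} (hz : 1 ≤ z) :
    s.mainSum (lambdaSquared (s.selbergWeights z)) = (s.selbergSum z)⁻¹ := by
  have hG := (selbergSum_pos (s := s) hz).ne'
  rw [mainSum_lambdaSquared_eq_sum_mul_sum_sq]
  have h : ∀ l ∈ s.prodPrimes.divisors, (s.selbergTerms l)⁻¹ *
      (∑ d ∈ s.prodPrimes.divisors, if l ∣ d then s.nu d * s.selbergWeights z d else 0) ^ 2 =
      if l ≤ z then (s.selbergSum z)⁻¹ ^ 2 * s.selbergTerms l else 0 := by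
    intro l hl
    have hg := (selbergTerms_pos (dvd_of_mem_divisors hl)).ne'
    have hμ : (μ l : ℝ) ^ 2 = 1 := by
      exact_mod_cast moebius_sq_eq_one_of_squarefree
        (squarefree_of_mem_divisors_prodPrimes hl)
    rw [sum_nu_mul_selbergWeights (dvd_of_mem_divisors hl)]
    split_ifs
    · rw [mul_pow, mul_pow, hμ]; field_simp
    · simp
  rw [Finset.sum_congr rfl h, ← Finset.sum_filter, ← Finset.mul_sum]
  change (s.selbergSum z)⁻¹ ^ 2 * s.selbergSum z = _
  field_simp

/-- The crude bound `|w d| ≤ 1 / ν(d) ≤ d ≤ z` for the weights is enough, since any fixed power of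
`z` will do. -/
lemma errSum_selbergWeights_le {z : ℕ} (hz : 1 ≤ z)
    (hν : ∀ d, d ∣ s.prodPrimes → 1 ≤ d * s.nu d) (hrem : ∀ d, d ∣ s.prodPrimes → |s.rem d| ≤ d) :
    s.errSum (lambdaSquared (s.selbergWeights z)) ≤ (z : ℝ) ^ 6 := by
  set w := s.selbergWeights z with hw
  set D := s.prodPrimes.divisors with hD
  have hwd : ∀ d ∈ D, |w d| * d ≤ if d ≤ z then (z : ℝ) ^ 2 else 0 := by
    intro d hd
    have hdP := dvd_of_mem_divisors hd
    split_ifs with hdz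
    · have h1 := abs_selbergWeights_le hz hdP
      have h2 : (s.nu d)⁻¹ ≤ d := by
        rw [inv_le_iff_one_le_mul₀ (nu_pos_of_dvd_prodPrimes hdP)]
        exact hν d hdP
      have h3 : (d : ℝ) ≤ z := by exact_mod_cast hdz
      rw [sq]
      exact mul_le_mul ((h1.trans h2).trans h3) h3 (by positivity) (by positivity)
    · rw [hw, selbergWeights_eq_zero (not_le.1 hdz)]; simp
  have hsum : ∑ d ∈ D, |w d| * d ≤ (z : ℝ) ^ 3 := by
    refine (Finset.sum_le_sum hwd).trans ?_
    rw [← Finset.sum_filter, Finset.sum_const, nsmul_eq_mul]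
    have : (D.filter (· ≤ z)).card ≤ z := by
      refine (Finset.card_le_card (t := Finset.Icc 1 z) fun d hd => ?_).trans (by simp)
      obtain ⟨hd, hdz⟩ := Finset.mem_filter.1 hd
      exact Finset.mem_Icc.2 ⟨Nat.pos_of_mem_divisors hd, hdz⟩
    have : ((D.filter (· ≤ z)).card : ℝ) ≤ z := by exact_mod_cast this
    nlinarith [sq_nonneg (z : ℝ)]
  have hterm : ∀ d ∈ D, |lambdaSquared w d| * |s.rem d| ≤
      ∑ d1 ∈ D, ∑ d2 ∈ D, if d = d1.lcm d2 then (|w d1| * d1) * (|w d2| * d2) else 0 := by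
    intro d hd
    have hdP := dvd_of_mem_divisors hd
    have hsub : d.divisors ⊆ D := Nat.divisors_subset_of_dvd prodPrimes_ne_zero hdP
    have h1 : |lambdaSquared w d| ≤
        ∑ d1 ∈ D, ∑ d2 ∈ D, if d = d1.lcm d2 then |w d1| * |w d2| else 0 := by
      rw [lambdaSquared]
      refine (Finset.abs_sum_le_sum_abs _ _).trans ?_
      refine (Finset.sum_le_sum fun d1 _ => Finset.abs_sum_le_sum_abs _ _).trans ?_
      have : ∀ d1 d2, |if d = d1.lcm d2 then w d1 * w d2 else 0| =
          if d = d1.lcm d2 then |w d1| * |w d2| else 0 := by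
        intro d1 d2; split_ifs <;> simp [abs_mul]
      simp only [this]
      have hnn : ∀ d1 d2, 0 ≤ if d = d1.lcm d2 then |w d1| * |w d2| else 0 := by
        intro d1 d2; split_ifs <;> positivity
      refine (Finset.sum_le_sum fun d1 _ => Finset.sum_le_sum_of_subset_of_nonneg hsub
        fun d2 _ _ => hnn d1 d2).trans ?_
      exact Finset.sum_le_sum_of_subset_of_nonneg hsub fun d1 _ _ =>
        Finset.sum_nonneg fun d2 _ => hnn d1 d2
    refine (mul_le_mul h1 (hrem d hdP) (abs_nonneg _) ((abs_nonneg _).trans h1)).trans ?_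
    rw [Finset.sum_mul]
    refine Finset.sum_le_sum fun d1 _ => ?_
    rw [Finset.sum_mul]
    refine Finset.sum_le_sum fun d2 hd2 => ?_
    split_ifs with h
    · have h2 : (d : ℝ) ≤ d1 * d2 := by
        rw [h]
        have := Nat.div_le_self (d1 * d2) (d1.gcd d2)
        exact_mod_cast this
      calc |w d1| * |w d2| * d ≤ |w d1| * |w d2| * (d1 * d2) := by gcongr
        _ = _ := by ring
    · simp
  calc s.errSum (lambdaSquared w)
      ≤ ∑ d ∈ D, ∑ d1 ∈ D, ∑ d2 ∈ D,
          if d = d1.lcm d2 then (|w d1| * d1) * (|w d2| * d2) else 0 := Finset.sum_le_sum hterm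
    _ = ∑ d1 ∈ D, ∑ d2 ∈ D, ∑ d ∈ D,
          if d = d1.lcm d2 then (|w d1| * d1) * (|w d2| * d2) else 0 := by
        rw [Finset.sum_comm]
        exact Finset.sum_congr rfl fun _ _ => Finset.sum_comm
    _ ≤ ∑ d1 ∈ D, ∑ d2 ∈ D, (|w d1| * d1) * (|w d2| * d2) := by
        refine Finset.sum_le_sum fun d1 _ => Finset.sum_le_sum fun d2 _ => ?_
        rw [Finset.sum_ite_eq']
        split_ifs
        · exact le_rfl
        · positivity
    _ = (∑ d ∈ D, |w d| * d) ^ 2 := by rw [sq, Finset.sum_mul_sum]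
    _ ≤ ((z : ℝ) ^ 3) ^ 2 := by
        have : 0 ≤ ∑ d ∈ D, |w d| * d := Finset.sum_nonneg fun d _ => by positivity
        gcongr
    _ = (z : ℝ) ^ 6 := by ring

/-- Selberg's upper bound, with a crude error term. -/
theorem siftedSum_le_selberg {z : ℕ} (hz : 1 ≤ z)
    (hν : ∀ d, d ∣ s.prodPrimes → 1 ≤ d * s.nu d) (hrem : ∀ d, d ∣ s.prodPrimes → |s.rem d| ≤ d) :
    s.siftedSum ≤ s.totalMass / s.selbergSum z + (z : ℝ) ^ 6 := by
  have h := siftedSum_le_mainSum_errSum_of_upperMoebius (s := s) _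
    (upperMoebius_lambdaSquared _ (selbergWeights_one (s := s) hz))
  rw [mainSum_selbergWeights hz, ← div_eq_mul_inv] at h
  exact h.trans (by gcongr; exact errSum_selbergWeights_le hz hν hrem)

end BoundingSieve

/-! ### The sieve for prime pairs -/

section

open Nat ArithmeticFunction

/-- The solutions of `r (r + h) = 0` in `ZMod d`. -/
abbrev ShiftRoots (h d : ℕ) : Type := {r : ZMod d // r * (r + h) = 0}

lemma card_shiftRoots_mul {h m n : ℕ} (hmn : m.Coprime n) :
    Nat.card (ShiftRoots h (m * n)) = Nat.card (ShiftRoots h m) * Nat.card (ShiftRoots h n) := by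
  rw [← Nat.card_prod]
  let e := ZMod.chineseRemainder hmn
  refine Nat.card_congr ((e.toEquiv.subtypeEquiv (p := fun r : ZMod (m * n) => r * (r + h) = 0)
    (q := fun r : ZMod m × ZMod n => r.1 * (r.1 + h) = 0 ∧ r.2 * (r.2 + h) = 0) fun r => ?_).trans
    (Equiv.subtypeProdEquivProd (p := fun r : ZMod m => r * (r + h) = 0)
      (q := fun r : ZMod n => r * (r + h) = 0)))
  rw [← map_eq_zero_iff e e.injective, map_mul, map_add, map_natCast, Prod.ext_iff]
  simp [e]

lemma card_shiftRoots_prime {h p : ℕ} (hp : p.Prime) (hph : ¬ p ∣ h) :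
    Nat.card (ShiftRoots h p) = 2 := by
  have := Fact.mk hp
  have hne : (h : ZMod p) ≠ 0 := fun h0 => hph ((ZMod.natCast_eq_zero_iff h p).1 h0)
  have : {r : ZMod p | r * (r + h) = 0} = {0, -(h : ZMod p)} := by
    ext r
    simp [add_eq_zero_iff_eq_neg]
  rw [show Nat.card (ShiftRoots h p) = Set.ncard {r : ZMod p | r * (r + h) = 0} from rfl, this]
  exact Set.ncard_pair (by simpa using hne)

lemma card_shiftRoots_one (h : ℕ) : Nat.card (ShiftRoots h 1) = 1 := by
  have : Subsingleton (ZMod 1) := inferInstanceAs (Subsingleton (Fin 1))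
  have : Nonempty (ShiftRoots h 1) := ⟨⟨0, Subsingleton.elim _ _⟩⟩
  exact Nat.card_unique

/-- The sieve density: the multiplicative function with value `2 / p` at the prime `p`, the
proportion of residues `r` modulo `p` with `p ∣ r (r + h)`, for `p ∤ h`. -/
noncomputable def pairDensity : ArithmeticFunction ℝ := prodPrimeFactors fun p => 2 / (p : ℝ)

lemma pairDensity_isMultiplicative : pairDensity.IsMultiplicative :=
  IsMultiplicative.prodPrimeFactors _

lemma pairDensity_prime {p : ℕ} (hp : p.Prime) : pairDensity p = 2 / p := by
  rw [pairDensity, prodPrimeFactors_apply hp.ne_zero, hp.primeFactors, Finset.prod_singleton]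

lemma mul_pairDensity {h d : ℕ} (hd : Squarefree d) (hdh : d.Coprime h) :
    d * pairDensity d = Nat.card (ShiftRoots h d) := by
  induction d using Nat.recOnPosPrimePosCoprime with
  | zero => exact absurd hd (by simp)
  | one =>
    rw [card_shiftRoots_one, pairDensity_isMultiplicative.map_one]; simp
  | prime_pow p n hp hn =>
    have hn1 : n = 1 := ((Nat.squarefree_pow_iff hp.ne_one hn.ne').1 hd).2
    subst hn1
    rw [pow_one] at hdh ⊢
    have : (p : ℝ) ≠ 0 := by exact_mod_cast hp.ne_zero
    rw [pairDensity_prime hp, card_shiftRoots_prime hp (hp.coprime_iff_not_dvd.1 hdh)]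
    field_simp
    norm_num
  | coprime a b ha hb hab iha ihb =>
    obtain ⟨-, hsa, hsb⟩ := Nat.squarefree_mul_iff.1 hd
    rw [card_shiftRoots_mul hab, pairDensity_isMultiplicative.map_mul_of_coprime hab]
    push_cast
    rw [← iha hsa (hdh.coprime_dvd_left (dvd_mul_right a b)),
      ← ihb hsb (hdh.coprime_dvd_left (dvd_mul_left b a))]
    ring

lemma abs_count_modEq_sub_le {d : ℕ} (hd : 0 < d) (x v : ℕ) :
    |((Nat.count (· ≡ v [MOD d]) x : ℕ) : ℝ) - x / d| ≤ 1 := by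
  rw [Nat.count_modEq_card x hd v]
  have hd' : (0 : ℝ) < d := by exact_mod_cast hd
  have h1 : (x : ℝ) / d = (x / d : ℕ) + ((x % d : ℕ) : ℝ) / d := by
    have : (x : ℝ) = d * (x / d : ℕ) + (x % d : ℕ) := by exact_mod_cast (Nat.div_add_mod x d).symm
    field_simp
    linarith
  have h2 : ((x % d : ℕ) : ℝ) / d ≤ 1 := by
    rw [div_le_one hd']; exact_mod_cast (Nat.mod_lt x hd).le
  have h3 : 0 ≤ ((x % d : ℕ) : ℝ) / d := by positivity
  rw [h1, abs_le]
  split_ifs <;> push_cast <;> constructor <;> linarith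

/-- The count of `m < x` with `d ∣ m (m + h)` is `x / d` times the number of roots, up to the
number of roots. -/
lemma abs_card_dvd_sub_le {d : ℕ} (hd : 0 < d) (h x : ℕ) :
    |(((Finset.range x).filter fun m => d ∣ m * (m + h)).card : ℝ) -
      Nat.card (ShiftRoots h d) * (x / d)| ≤ Nat.card (ShiftRoots h d) := by
  have : NeZero d := ⟨hd.ne'⟩
  classical
  set R : Finset (ZMod d) := Finset.univ.filter fun r => r * (r + h) = 0 with hR
  have hcard : Nat.card (ShiftRoots h d) = R.card := by
    rw [Nat.card_eq_fintype_card, Fintype.card_subtype]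
  have hmaps : ∀ m ∈ (Finset.range x).filter fun m => d ∣ m * (m + h), (m : ZMod d) ∈ R := by
    intro m hm
    have := (ZMod.natCast_eq_zero_iff _ _).2 (Finset.mem_filter.1 hm).2
    simpa [hR] using this
  have hfib : ∀ r ∈ R, (((Finset.range x).filter fun m => d ∣ m * (m + h)).filter
      fun m : ℕ => (m : ZMod d) = r).card = Nat.count (· ≡ r.val [MOD d]) x := by
    intro r hr
    rw [Nat.count_eq_card_filter_range, Finset.filter_filter]
    congr 1
    ext m
    simp only [Finset.mem_filter, Finset.mem_range, and_congr_right_iff]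
    intro _
    rw [← ZMod.natCast_eq_natCast_iff, ZMod.natCast_zmod_val]
    constructor
    · exact And.right
    · rintro rfl
      refine ⟨(ZMod.natCast_eq_zero_iff _ _).1 ?_, rfl⟩
      simpa [hR] using hr
  rw [Finset.card_eq_sum_card_fiberwise hmaps, Finset.sum_congr rfl hfib, hcard]
  push_cast
  rw [← nsmul_eq_mul, ← Finset.sum_const, ← Finset.sum_sub_distrib]
  refine (Finset.abs_sum_le_sum_abs _ _).trans ?_
  refine (Finset.sum_le_sum fun r _ => abs_count_modEq_sub_le hd x r.val).trans ?_
  simp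

/-- The product of the primes `p ≤ z` not dividing `2 h`. -/
def siftingProduct (h z : ℕ) : ℕ := ∏ p ∈ (primesLE z).filter (¬ · ∣ 2 * h), p

lemma prime_dvd_siftingProduct {h z p : ℕ} (hp : p.Prime) :
    p ∣ siftingProduct h z ↔ p ≤ z ∧ ¬ p ∣ 2 * h := by
  rw [siftingProduct, hp.prime.dvd_finsetProd_iff]
  constructor
  · rintro ⟨q, hq, hpq⟩
    rw [Finset.mem_filter, mem_primesLE] at hq
    rw [(Nat.prime_dvd_prime_iff_eq hp hq.1.2).1 hpq]
    exact ⟨hq.1.1, hq.2⟩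
  · rintro ⟨h1, h2⟩
    exact ⟨p, by simp [mem_primesLE, h1, hp, h2], dvd_rfl⟩

lemma squarefree_siftingProduct (h z : ℕ) : Squarefree (siftingProduct h z) := by
  refine Finset.squarefree_prod_of_pairwise_isCoprime ?_ ?_
  · intro p hp q hq hpq
    simp only [Finset.coe_filter, mem_primesLE, Set.mem_ofPred_eq] at hp hq
    exact Nat.coprime_iff_isRelPrime.1 ((Nat.coprime_primes hp.1.2 hq.1.2).2 hpq)
  · intro p hp
    rw [Finset.mem_filter, mem_primesLE] at hp
    exact hp.1.2.prime.squarefree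

lemma coprime_siftingProduct (h z : ℕ) : (siftingProduct h z).Coprime (2 * h) := by
  refine Nat.Coprime.prod_left fun p hp => ?_
  rw [Finset.mem_filter, mem_primesLE] at hp
  exact hp.1.2.coprime_iff_not_dvd.2 hp.2

lemma three_le_of_dvd_siftingProduct {h z p : ℕ} (hp : p.Prime) (hd : p ∣ siftingProduct h z) :
    3 ≤ p := by
  have h1 := ((prime_dvd_siftingProduct hp).1 hd).2
  have h2 : p ≠ 2 := by rintro rfl; exact h1 (dvd_mul_right 2 h)
  have := hp.two_le
  omega

/-- The sieve of the products `m (m + h)`, `m < x`, by the primes `p ≤ z` with `p ∤ 2 h`. -/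
noncomputable def pairSieve (h x z : ℕ) : BoundingSieve where
  support := (Finset.range x).image fun m => m * (m + h)
  prodPrimes := siftingProduct h z
  prodPrimes_squarefree := squarefree_siftingProduct h z
  weights := fun _ => 1
  weights_nonneg := fun _ => zero_le_one
  totalMass := x
  nu := pairDensity
  nu_mult := pairDensity_isMultiplicative
  nu_pos_of_prime := fun p hp _ => by
    have : (0 : ℝ) < p := by exact_mod_cast hp.pos
    rw [pairDensity_prime hp]; positivity
  nu_lt_one_of_prime := fun p hp hd => by
    have h3 : (3 : ℝ) ≤ p := by exact_mod_cast three_le_of_dvd_siftingProduct hp hd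
    rw [pairDensity_prime hp, div_lt_one (by linarith)]
    linarith

lemma shift_mul_injective {h : ℕ} (hh : 0 < h) : Function.Injective fun m : ℕ => m * (m + h) := by
  refine StrictMono.injective fun a b hab => ?_
  change a * (a + h) < b * (b + h)
  nlinarith

lemma card_shiftRoots_pos {h d : ℕ} (hd : 0 < d) : 1 ≤ Nat.card (ShiftRoots h d) := by
  have : NeZero d := ⟨hd.ne'⟩
  have : Nonempty (ShiftRoots h d) := ⟨⟨0, by simp⟩⟩
  exact Nat.card_pos

lemma card_shiftRoots_le {h d : ℕ} (hd : 0 < d) : Nat.card (ShiftRoots h d) ≤ d := by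
  have : NeZero d := ⟨hd.ne'⟩
  calc Nat.card (ShiftRoots h d) ≤ Nat.card (ZMod d) := Nat.card_le_card_of_injective _
        Subtype.val_injective
    _ = d := Nat.card_zmod d

lemma mul_nu_pairSieve {h z d : ℕ} (hd : d ∣ siftingProduct h z) :
    d * pairDensity d = Nat.card (ShiftRoots h d) :=
  mul_pairDensity ((squarefree_siftingProduct h z).squarefree_of_dvd hd)
    ((coprime_siftingProduct h z).coprime_dvd_left hd |>.coprime_mul_left_right)

lemma abs_rem_pairSieve_le {h x z d : ℕ} (hh : 0 < h) (hd : d ∣ siftingProduct h z) :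
    |(pairSieve h x z).rem d| ≤ d := by
  have hd0 : 0 < d := Nat.pos_of_ne_zero fun h0 =>
    (squarefree_siftingProduct h z).ne_zero (Nat.eq_zero_of_zero_dvd (h0 ▸ hd))
  have hd0' : (d : ℝ) ≠ 0 := by exact_mod_cast hd0.ne'
  have h1 : (pairSieve h x z).multSum d =
      ((Finset.range x).filter fun m => d ∣ m * (m + h)).card := by
    simp only [BoundingSieve.multSum, pairSieve]
    rw [Finset.sum_image fun a _ b _ hab => shift_mul_injective hh hab, Finset.sum_boole]
  have h2 : (pairSieve h x z).nu d * (pairSieve h x z).totalMass =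
      Nat.card (ShiftRoots h d) * (x / d) := by
    rw [← mul_nu_pairSieve hd]
    simp only [pairSieve]
    field_simp
  rw [BoundingSieve.rem, h1, h2]
  exact (abs_card_dvd_sub_le hd0 h x).trans (by exact_mod_cast card_shiftRoots_le hd0)

/-- The number of `p < x` for which `p` and `p + h` are both prime. -/
def pairCount (h x : ℕ) : ℕ :=
  ((Finset.range x).filter fun p => p.Prime ∧ (p + h).Prime).card

lemma pairCount_le_siftedSum {h : ℕ} (hh : 0 < h) (x z : ℕ) :
    (pairCount h x : ℝ) ≤ (pairSieve h x z).siftedSum + (z + 1) := by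
  have h1 : (pairSieve h x z).siftedSum =
      ((Finset.range x).filter fun m => (siftingProduct h z).Coprime (m * (m + h))).card := by
    rw [BoundingSieve.siftedSum]
    change ∑ n ∈ (Finset.range x).image fun m => m * (m + h),
      (if (siftingProduct h z).Coprime n then (1 : ℝ) else 0) = _
    rw [Finset.sum_image fun a _ b _ hab => shift_mul_injective hh hab, Finset.sum_boole]
  have h2 : (Finset.range x).filter (fun p => p.Prime ∧ (p + h).Prime) ⊆
      (Finset.range x).filter (fun m => (siftingProduct h z).Coprime (m * (m + h))) ∪
        Finset.range (z + 1) := by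
    intro p hp
    obtain ⟨hpx, hp1, hp2⟩ := Finset.mem_filter.1 hp
    rcases Nat.lt_or_ge p (z + 1) with hpz | hpz
    · exact Finset.mem_union_right _ (Finset.mem_range.2 hpz)
    · refine Finset.mem_union_left _ (Finset.mem_filter.2 ⟨hpx, ?_⟩)
      refine Nat.Coprime.mul_right ?_ ?_
      · refine ((hp1.coprime_iff_not_dvd).2 fun hd => ?_).symm
        have := ((prime_dvd_siftingProduct hp1).1 hd).1
        omega
      · refine ((hp2.coprime_iff_not_dvd).2 fun hd => ?_).symm
        have := ((prime_dvd_siftingProduct hp2).1 hd).1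
        omega
  have h3 := (Finset.card_le_card h2).trans (Finset.card_union_le _ _)
  rw [Finset.card_range] at h3
  rw [h1, pairCount]
  exact_mod_cast h3

lemma pairCount_le_selberg {h z : ℕ} (hh : 0 < h) (hz : 1 ≤ z) (x : ℕ) :
    (pairCount h x : ℝ) ≤ x / (pairSieve h x z).selbergSum z + z ^ 6 + (z + 1) := by
  refine (pairCount_le_siftedSum hh x z).trans ?_
  gcongr
  refine BoundingSieve.siftedSum_le_selberg hz (fun d hd => ?_) fun d hd =>
    abs_rem_pairSieve_le hh hd
  have hd0 : 0 < d := Nat.pos_of_ne_zero fun h0 =>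
    (squarefree_siftingProduct h z).ne_zero (Nat.eq_zero_of_zero_dvd (h0 ▸ hd))
  change 1 ≤ d * pairDensity d
  rw [mul_nu_pairSieve hd]
  exact_mod_cast card_shiftRoots_pos hd0

end

/-! ### A lower bound for the Selberg sum -/

section

open Nat ArithmeticFunction
open scoped ArithmeticFunction.Omega

lemma card_divisors_le_two_pow (n : ℕ) (hn : n ≠ 0) : n.divisors.card ≤ 2 ^ Ω n := by
  induction n using induction_on_primes with
  | zero => exact absurd rfl hn
  | one => simp
  | prime_mul p a hp ih =>
    have ha : a ≠ 0 := right_ne_zero_of_mul hn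
    have hsub : (p * a).divisors ⊆ a.divisors ∪ a.divisors.image (p * ·) := by
      intro d hd
      have hd' := dvd_of_mem_divisors hd
      by_cases hpd : p ∣ d
      · obtain ⟨e, rfl⟩ := hpd
        exact Finset.mem_union_right _ (Finset.mem_image.2
          ⟨e, Nat.mem_divisors.2 ⟨Nat.dvd_of_mul_dvd_mul_left hp.pos hd', ha⟩, rfl⟩)
      · exact Finset.mem_union_left _ (Nat.mem_divisors.2
          ⟨((hp.coprime_iff_not_dvd.2 hpd).symm).dvd_of_dvd_mul_left hd', ha⟩)
    calc (p * a).divisors.card ≤ a.divisors.card + (a.divisors.image (p * ·)).card :=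
          (Finset.card_le_card hsub).trans (Finset.card_union_le _ _)
      _ ≤ 2 ^ Ω a + 2 ^ Ω a := by
          gcongr
          · exact ih ha
          · exact Finset.card_image_le.trans (ih ha)
      _ = 2 ^ Ω (p * a) := by
          rw [cardFactors_mul hp.ne_zero ha, cardFactors_apply_prime hp]; ring

/-- The completely multiplicative function with value `2 / p` at the odd primes `p` and `0` at
`2`, where the geometric series of the Euler product would diverge. -/
noncomputable def twoPowOmegaDiv : ℕ →* ℝ where
  toFun n := if Odd n then 2 ^ Ω n / (n : ℝ) else 0
  map_one' := by simp
  map_mul' m n := by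
    by_cases hm : Odd m
    · by_cases hn : Odd n
      · simp only [hm, hn, hm.mul hn, if_true]
        rw [cardFactors_mul hm.pos.ne' hn.pos.ne', pow_add]
        push_cast
        ring
      · simp [hn, Nat.odd_mul]
    · simp [hm, Nat.odd_mul]

lemma twoPowOmegaDiv_apply {n : ℕ} (hn : Odd n) : twoPowOmegaDiv n = 2 ^ Ω n / (n : ℝ) :=
  if_pos hn

lemma twoPowOmegaDiv_nonneg (n : ℕ) : 0 ≤ twoPowOmegaDiv n := by
  change 0 ≤ if Odd n then 2 ^ Ω n / (n : ℝ) else 0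
  split_ifs <;> positivity

lemma twoPowOmegaDiv_prime {p : ℕ} (hp : p.Prime) (h2 : p ≠ 2) :
    twoPowOmegaDiv p = pairDensity p := by
  rw [twoPowOmegaDiv_apply (hp.odd_of_ne_two h2), cardFactors_apply_prime hp,
    pairDensity_prime hp, pow_one]

lemma norm_twoPowOmegaDiv_prime_lt_one {p : ℕ} (hp : p.Prime) : ‖twoPowOmegaDiv p‖ < 1 := by
  by_cases h2 : p = 2
  · subst h2
    have : twoPowOmegaDiv 2 = 0 :=
      if_neg (t := 2 ^ Ω 2 / ((2 : ℕ) : ℝ)) (show ¬ Odd 2 by decide)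
    simp [this]
  · rw [Real.norm_of_nonneg (twoPowOmegaDiv_nonneg p), twoPowOmegaDiv_prime hp h2,
      pairDensity_prime hp]
    have h3 : (3 : ℝ) ≤ p := by
      have := hp.two_le
      exact_mod_cast (show 3 ≤ p by omega)
    rw [div_lt_one (by linarith)]
    linarith

lemma twoPowOmegaDiv_eq_pairDensity {h z l : ℕ} (hl : l ∣ siftingProduct h z) :
    twoPowOmegaDiv l = pairDensity l := by
  have hsq := (squarefree_siftingProduct h z).squarefree_of_dvd hl
  conv_lhs => rw [← Nat.prod_primeFactors_of_squarefree hsq]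
  rw [map_prod, pairDensity, prodPrimeFactors_apply hsq.ne_zero]
  refine Finset.prod_congr rfl fun p hp => ?_
  have hpp := prime_of_mem_primeFactors hp
  have := three_le_of_dvd_siftingProduct hpp ((dvd_of_mem_primeFactors hp).trans hl)
  rw [twoPowOmegaDiv_prime hpp (by omega), pairDensity_prime hpp]

/-- Selberg's `g(l)` bounds the sum of `2 ^ Ω(n) / n` over integers `n` with radical `l`, by the
Euler product over the primes dividing `l`. -/
lemma sum_twoPowOmegaDiv_le_selbergTerms {h x z l : ℕ} (hl : l ∣ siftingProduct h z) (F : Finset ℕ)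
    (hF : ∀ n ∈ F, n ≠ 0 ∧ ∏ p ∈ n.primeFactors, p = l) :
    ∑ n ∈ F, twoPowOmegaDiv n ≤ (pairSieve h x z).selbergTerms l := by
  have hsq := (squarefree_siftingProduct h z).squarefree_of_dvd hl
  have hl0 : 0 < l := Nat.pos_of_ne_zero hsq.ne_zero
  have hdvd : ∀ n ∈ F, l ∣ n := fun n hn => (hF n hn).2 ▸ Nat.prod_primeFactors_dvd n
  have hprod : ∏ p ∈ l.primeFactors with p.Prime, (1 - twoPowOmegaDiv p)⁻¹ =
      ∏ p ∈ l.primeFactors, (1 - pairDensity p)⁻¹ := by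
    rw [Finset.filter_true_of_mem fun p hp => prime_of_mem_primeFactors hp]
    refine Finset.prod_congr rfl fun p hp => ?_
    have hpp := prime_of_mem_primeFactors hp
    have := three_le_of_dvd_siftingProduct hpp ((dvd_of_mem_primeFactors hp).trans hl)
    rw [twoPowOmegaDiv_prime hpp (by omega)]
  have hsum := (EulerProduct.summable_and_hasSum_factoredNumbers_prod_filter_prime_geometric
    norm_twoPowOmegaDiv_prime_lt_one l.primeFactors).2
  rw [hprod] at hsum
  have hind : HasSum (Set.indicator (factoredNumbers l.primeFactors) twoPowOmegaDiv)
      (∏ p ∈ l.primeFactors, (1 - pairDensity p)⁻¹) := hasSum_subtype_iff_indicator.1 hsum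
  have hle : ∑ m ∈ F.image (· / l), twoPowOmegaDiv m ≤
      ∏ p ∈ l.primeFactors, (1 - pairDensity p)⁻¹ := by
    refine le_trans (le_of_eq ?_) (sum_le_hasSum (F.image (· / l))
      (fun m _ => Set.indicator_nonneg (fun m _ => twoPowOmegaDiv_nonneg m) m) hind)
    refine Finset.sum_congr rfl fun m hm => (Set.indicator_of_mem ?_ _).symm
    obtain ⟨n, hn, rfl⟩ := Finset.mem_image.1 hm
    refine mem_factoredNumbers'.2 fun p hp hpm => ?_
    have h1 : p ∣ n := hpm.trans (Nat.div_dvd_of_dvd (hdvd n hn))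
    have h2 : p ∣ l := (hF n hn).2 ▸ Finset.dvd_prod_of_mem _
      (Nat.mem_primeFactors.2 ⟨hp, h1, (hF n hn).1⟩)
    exact Nat.mem_primeFactors.2 ⟨hp, h2, hl0.ne'⟩
  rw [Finset.sum_image fun a ha b hb hab => by
    rw [← Nat.div_mul_cancel (hdvd a ha), ← Nat.div_mul_cancel (hdvd b hb)]
    exact congr_arg (· * l) hab] at hle
  have hfac : ∀ n ∈ F, twoPowOmegaDiv n = pairDensity l * twoPowOmegaDiv (n / l) := by
    intro n hn
    rw [← twoPowOmegaDiv_eq_pairDensity hl, ← map_mul, Nat.mul_div_cancel' (hdvd n hn)]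
  have hν : 0 ≤ pairDensity l := by
    rw [← twoPowOmegaDiv_eq_pairDensity hl]; exact twoPowOmegaDiv_nonneg l
  rw [Finset.sum_congr rfl hfac, ← Finset.mul_sum, BoundingSieve.selbergTerms_apply]
  exact mul_le_mul_of_nonneg_left hle hν

/-- The square is a sum over products `n = a b ≤ z`, each occurring at most `2 ^ Ω(n)` times; the
products are then grouped by their radical. -/
lemma sq_sum_inv_le_selbergSum {h x z : ℕ} (A : Finset ℕ) (hA : ∀ a ∈ A, a.Coprime (2 * h))
    (hA0 : ∀ a ∈ A, a ≠ 0) (hAz : ∀ a ∈ A, ∀ b ∈ A, a * b ≤ z) :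
    (∑ a ∈ A, (a : ℝ)⁻¹) ^ 2 ≤ (pairSieve h x z).selbergSum z := by
  set N := (A ×ˢ A).image fun q => q.1 * q.2 with hN
  have hNprop : ∀ n ∈ N, n ≠ 0 ∧ n.Coprime (2 * h) ∧ n ≤ z := by
    intro n hn
    obtain ⟨⟨a, b⟩, hq, rfl⟩ := Finset.mem_image.1 hn
    obtain ⟨ha, hb⟩ := Finset.mem_product.1 hq
    exact ⟨mul_ne_zero (hA0 a ha) (hA0 b hb), (hA a ha).mul_left (hA b hb), hAz a ha b hb⟩
  have h1 : (∑ a ∈ A, (a : ℝ)⁻¹) ^ 2 ≤ ∑ n ∈ N, twoPowOmegaDiv n := by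
    rw [sq, Finset.sum_mul_sum, ← Finset.sum_product',
      ← Finset.sum_fiberwise_of_maps_to (t := N) (g := fun q : ℕ × ℕ => q.1 * q.2)
        (fun q hq => Finset.mem_image_of_mem _ hq)]
    refine Finset.sum_le_sum fun n hn => ?_
    obtain ⟨hn0, hnc, -⟩ := hNprop n hn
    have hodd : Odd n := by
      rw [← Nat.not_even_iff_odd]
      intro he
      have := Nat.dvd_gcd he.two_dvd (dvd_mul_right 2 h)
      rw [hnc] at this
      omega
    have hterm : ∀ q ∈ (A ×ˢ A).filter fun q => q.1 * q.2 = n,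
        (q.1 : ℝ)⁻¹ * (q.2 : ℝ)⁻¹ = (n : ℝ)⁻¹ := by
      intro q hq
      rw [← mul_inv, ← Nat.cast_mul, (Finset.mem_filter.1 hq).2]
    have hcard : ((A ×ˢ A).filter fun q => q.1 * q.2 = n).card ≤ 2 ^ Ω n := by
      refine le_trans ?_ (card_divisors_le_two_pow n hn0)
      refine Finset.card_le_card_of_injOn Prod.fst (fun q hq => ?_) fun q hq r hr hqr => ?_
      · have hq := (Finset.mem_filter.1 hq).2
        exact Nat.mem_divisors.2 ⟨Dvd.intro _ hq, hn0⟩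
      · have hq := (Finset.mem_filter.1 hq).2
        have hr := (Finset.mem_filter.1 hr).2
        rw [← hq, hqr] at hr
        have h0 : 0 < r.1 := Nat.pos_of_ne_zero fun h0 => hn0 (by rw [← hq, hqr, h0, zero_mul])
        exact Prod.ext hqr (Nat.eq_of_mul_eq_mul_left h0 hr.symm)
    rw [Finset.sum_congr rfl hterm, Finset.sum_const, nsmul_eq_mul, twoPowOmegaDiv_apply hodd,
      div_eq_mul_inv]
    gcongr
    exact_mod_cast hcard
  refine h1.trans ?_
  rw [BoundingSieve.selbergSum, ← Finset.sum_fiberwise_of_maps_to (s := N)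
    (t := (pairSieve h x z).prodPrimes.divisors.filter (· ≤ z))
    (g := fun n => ∏ p ∈ n.primeFactors, p)]
  · refine Finset.sum_le_sum fun l hl => sum_twoPowOmegaDiv_le_selbergTerms
      (dvd_of_mem_divisors (Finset.mem_filter.1 hl).1) _ fun n hn => ?_
    obtain ⟨hn, hnl⟩ := Finset.mem_filter.1 hn
    exact ⟨(hNprop n hn).1, hnl⟩
  · intro n hn
    obtain ⟨hn0, hnc, hnz⟩ := hNprop n hn
    refine Finset.mem_filter.2 ⟨Nat.mem_divisors.2 ⟨?_, (squarefree_siftingProduct h z).ne_zero⟩,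
      (Nat.le_of_dvd (Nat.pos_of_ne_zero hn0) (Nat.prod_primeFactors_dvd n)).trans hnz⟩
    refine Finset.prod_primes_dvd _ (fun p hp => (prime_of_mem_primeFactors hp).prime)
      fun p hp => ?_
    have hpp := prime_of_mem_primeFactors hp
    have hpn := dvd_of_mem_primeFactors hp
    refine (prime_dvd_siftingProduct hpp).2
      ⟨(Nat.le_of_dvd (Nat.pos_of_ne_zero hn0) hpn).trans hnz, fun hph => ?_⟩
    have := Nat.dvd_gcd hpn hph
    rw [hnc] at this
    exact hpp.one_lt.ne' (Nat.dvd_one.1 this)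

/-- The numbers `2 h k + 1` with `1 ≤ k ≤ K` are coprime to `2 h`. -/
lemma sq_log_le_selbergSum {h : ℕ} (hh : 0 < h) (x K : ℕ) :
    (Real.log (K + 1) / (2 * h + 1)) ^ 2 ≤
      (pairSieve h x ((2 * h * K + 1) ^ 2)).selbergSum ((2 * h * K + 1) ^ 2) := by
  have hinj : Function.Injective fun k : ℕ => 2 * h * (k + 1) + 1 := by
    intro a b hab
    have : 2 * h * (a + 1) = 2 * h * (b + 1) := by simpa using hab
    have := Nat.eq_of_mul_eq_mul_left (by omega) this
    omega
  refine le_trans ?_ (sq_sum_inv_le_selbergSum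
    ((Finset.range K).image fun k => 2 * h * (k + 1) + 1) ?_ ?_ ?_)
  · rw [Finset.sum_image fun a _ b _ hab => hinj hab]
    have hlog : 0 ≤ Real.log (K + 1) := Real.log_nonneg (by linarith [Nat.cast_nonneg (α := ℝ) K])
    gcongr
    have hH : Real.log (K + 1) ≤ ∑ k ∈ Finset.range K, ((k : ℝ) + 1)⁻¹ := by
      have := log_add_one_le_harmonic K
      simpa [harmonic] using this
    rw [div_eq_mul_inv]
    refine (mul_le_mul_of_nonneg_right hH (by positivity)).trans ?_
    rw [Finset.sum_mul]
    refine Finset.sum_le_sum fun k _ => ?_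
    rw [← mul_inv]
    refine inv_anti₀ (by positivity) ?_
    push_cast
    nlinarith [Nat.cast_nonneg (α := ℝ) k]
  · intro a ha
    obtain ⟨k, -, rfl⟩ := Finset.mem_image.1 ha
    exact (Nat.coprime_mul_left_add_left _ _ _).2 (Nat.coprime_one_left _)
  · intro a ha
    obtain ⟨k, -, rfl⟩ := Finset.mem_image.1 ha
    omega
  · intro a ha b hb
    obtain ⟨k, hk, rfl⟩ := Finset.mem_image.1 ha
    obtain ⟨j, hj, rfl⟩ := Finset.mem_image.1 hb
    rw [Finset.mem_range] at hk hj
    rw [sq]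
    gcongr <;> omega

/-- Selberg's bound for the number of prime pairs with difference `h`, with level
`(2 h K + 1) ^ 2`. -/
lemma pairCount_le {h : ℕ} (hh : 0 < h) {K : ℕ} (hK : 0 < K) (x : ℕ) :
    (pairCount h x : ℝ) ≤
      x * (2 * h + 1) ^ 2 / Real.log (K + 1) ^ 2 + 3 * ((2 * h + 1) * K) ^ 12 := by
  set z := (2 * h * K + 1) ^ 2 with hz
  have hz1 : 1 ≤ z := Nat.one_le_pow _ _ (by omega)
  have hlog : 0 < Real.log (K + 1) := Real.log_pos (by
    have : (0 : ℝ) < K := by exact_mod_cast hK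
    linarith)
  refine (pairCount_le_selberg hh hz1 x).trans ?_
  have h1 : (x : ℝ) / (pairSieve h x z).selbergSum z ≤
      x / (Real.log (K + 1) / (2 * h + 1)) ^ 2 := by
    gcongr
    exact sq_log_le_selbergSum hh x K
  have h2 : (x : ℝ) / (Real.log (K + 1) / (2 * h + 1)) ^ 2 =
      x * (2 * h + 1) ^ 2 / Real.log (K + 1) ^ 2 := by
    rw [div_pow, div_div_eq_mul_div]
  have h3 : (z : ℝ) ≤ ((2 * h + 1) * K) ^ 2 := by
    rw [hz]; push_cast
    have : (1 : ℝ) ≤ K := by exact_mod_cast hK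
    gcongr
    linarith
  have h4 : (1 : ℝ) ≤ z := by exact_mod_cast hz1
  have h5 : (z : ℝ) ^ 6 ≤ ((2 * h + 1) * K) ^ 12 := by
    calc (z : ℝ) ^ 6 ≤ (((2 * h + 1) * K) ^ 2) ^ 6 := by gcongr
      _ = _ := by ring
  have h6 : (z : ℝ) ≤ z ^ 6 := le_self_pow₀ h4 (by norm_num)
  have h7 : (1 : ℝ) ≤ z ^ 6 := one_le_pow₀ h4
  rw [h2] at h1
  linarith

end

/-! ### Density of the small prime gaps -/

lemma tendsto_pairCount_mul_log_div {h : ℕ} (hh : 0 < h) :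
    Tendsto (fun x : ℕ => (pairCount h x : ℝ) * Real.log x / x) atTop (𝓝 0) := by
  set C : ℝ := (2 * h + 1) ^ 2 * 24 ^ 2 with hC
  set B : ℝ := 3 * (2 * h + 1) ^ 12 with hB
  have hlog : Tendsto (fun x : ℕ => Real.log x) atTop atTop :=
    Real.tendsto_log_atTop.comp tendsto_natCast_atTop_atTop
  have hsq : Tendsto (fun x : ℕ => Real.log x / (x : ℝ) ^ (1 / 2 : ℝ)) atTop (𝓝 0) :=
    ((isLittleO_log_rpow_atTop (by norm_num)).tendsto_div_nhds_zero).comp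
      tendsto_natCast_atTop_atTop
  have hlim : Tendsto (fun x : ℕ => C / Real.log x + B * (Real.log x / (x : ℝ) ^ (1 / 2 : ℝ)))
      atTop (𝓝 0) := by
    simpa using (hlog.const_div_atTop C).add (hsq.const_mul B)
  refine squeeze_zero' (Eventually.of_forall fun x => ?_) ?_ hlim
  · have := Real.log_natCast_nonneg x
    positivity
  filter_upwards [eventually_ge_atTop 3] with x hx
  have hx3 : (3 : ℝ) ≤ x := by exact_mod_cast hx
  have hx0 : (0 : ℝ) < x := by linarith
  have hlx : 0 < Real.log x := Real.log_pos (by linarith)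
  -- The level of the sieve is about `x ^ (1 / 12)`, its error about `x ^ (1 / 2)`.
  set K := ⌊(x : ℝ) ^ (1 / 24 : ℝ)⌋₊ with hKdef
  have hK : 0 < K := Nat.floor_pos.2 (Real.one_le_rpow (by linarith) (by norm_num))
  have hKle : (K : ℝ) ≤ (x : ℝ) ^ (1 / 24 : ℝ) := Nat.floor_le (by positivity)
  have hKlog : Real.log x / 24 ≤ Real.log (K + 1) := by
    have h1 := Real.log_le_log (by positivity) (Nat.lt_floor_add_one ((x : ℝ) ^ (1 / 24 : ℝ))).le
    rw [Real.log_rpow hx0] at h1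
    linarith
  have h1 : (x : ℝ) * (2 * h + 1) ^ 2 / Real.log (K + 1) ^ 2 ≤ C * x / Real.log x ^ 2 := by
    calc (x : ℝ) * (2 * h + 1) ^ 2 / Real.log (K + 1) ^ 2
        ≤ x * (2 * h + 1) ^ 2 / (Real.log x / 24) ^ 2 := by gcongr
      _ = C * x / Real.log x ^ 2 := by rw [hC]; field_simp
  have h2 : 3 * ((2 * h + 1) * (K : ℝ)) ^ 12 ≤ B * (x : ℝ) ^ (1 / 2 : ℝ) := by
    have : (K : ℝ) ^ 12 ≤ (x : ℝ) ^ (1 / 2 : ℝ) := by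
      calc (K : ℝ) ^ 12 ≤ ((x : ℝ) ^ (1 / 24 : ℝ)) ^ 12 := by gcongr
        _ = (x : ℝ) ^ (1 / 2 : ℝ) := by
          rw [← Real.rpow_natCast, ← Real.rpow_mul hx0.le]; norm_num
    rw [mul_pow, hB, ← mul_assoc]
    gcongr
  have h3 := (pairCount_le hh hK x).trans (add_le_add h1 h2)
  have hhalf : (x : ℝ) = (x : ℝ) ^ (1 / 2 : ℝ) * (x : ℝ) ^ (1 / 2 : ℝ) := by
    rw [← Real.rpow_add hx0]; norm_num
  have hpos : 0 < (x : ℝ) ^ (1 / 2 : ℝ) := by positivity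
  calc (pairCount h x : ℝ) * Real.log x / x
      ≤ (C * x / Real.log x ^ 2 + B * (x : ℝ) ^ (1 / 2 : ℝ)) * Real.log x / x := by gcongr
    _ = C / Real.log x + B * ((x : ℝ) ^ (1 / 2 : ℝ) * Real.log x / x) := by field_simp
    _ = C / Real.log x + B * (Real.log x / (x : ℝ) ^ (1 / 2 : ℝ)) := by
        congr 2
        rw [div_eq_div_iff hx0.ne' hpos.ne']
        linear_combination -Real.log x * hhalf

/-- The order of magnitude of the number of primes from below, after Chebyshev. -/
lemma eventually_le_primeCounting_mul_log :
    ∀ᶠ x : ℕ in atTop, (x : ℝ) ≤ 2 * ((Nat.primeCounting x : ℝ) - 2) * Real.log x := by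
  have hlo : Tendsto (fun x : ℕ => Real.log x / (x : ℝ)) atTop (𝓝 0) := by
    have := (isLittleO_log_rpow_atTop (r := 1) (by norm_num)).tendsto_div_nhds_zero
    simp only [Real.rpow_one] at this
    exact this.comp tendsto_natCast_atTop_atTop
  filter_upwards [hlo.eventually_lt_const (show (0 : ℝ) < 1 / 100 by norm_num),
    eventually_ge_atTop 100] with x hlox hx100
  have hx : (100 : ℝ) ≤ x := by exact_mod_cast hx100
  have hlx : 0 < Real.log x := Real.log_pos (by linarith)
  rw [div_lt_iff₀ (by linarith)] at hlox
  have h1 := Chebyshev.pi_ge x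
  rw [div_le_iff₀ hlx] at h1
  have h2 : Real.log (x + 1) ≤ Real.log x + 1 := by
    have h := Real.log_le_log (by positivity) (show (x : ℝ) + 1 ≤ x * 2 by linarith)
    rw [Real.log_mul (by positivity) (by norm_num)] at h
    linarith [Real.log_two_lt_d9]
  have h3 := Real.log_two_gt_d9
  have h4 : (x : ℝ) * 0.69 ≤ x * Real.log 2 := by gcongr; linarith
  nlinarith

/-- The indices `s ≤ N` whose gap `pₛ₊₂ - pₛ₊₁` is at most `1100`. -/
noncomputable def smallGaps (N : ℕ) : Finset ℕ :=
  (Finset.Icc 1 N).filter fun s => prime (s + 2) ≤ 1100 + prime (s + 1)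

lemma card_smallGaps_le (N : ℕ) :
    (smallGaps N).card ≤ ∑ h ∈ Finset.Icc 1 1100, pairCount h (prime (N + 1) + 1) := by
  have hinj : Set.InjOn (fun s => prime (s + 1)) (smallGaps N : Set ℕ) := by
    intro a _ b _ hab
    have := prime_inj (i := a + 1) (j := b + 1) (by omega) (by omega) hab
    omega
  rw [← Finset.card_image_of_injOn hinj]
  -- Opaque, so that the interval is not unfolded.
  generalize hI : Finset.Icc 1 1100 = I
  refine le_trans (Finset.card_le_card ?_) (Finset.card_biUnion_le (s := I)
    (t := fun h => (Finset.range (prime (N + 1) + 1)).filter fun p => p.Prime ∧ (p + h).Prime))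
  intro p hp
  obtain ⟨s, hs, rfl⟩ := Finset.mem_image.1 hp
  obtain ⟨hsN, hgap⟩ := Finset.mem_filter.1 hs
  rw [Finset.mem_Icc] at hsN
  have hlt := prime_lt_prime (i := s + 1) (j := s + 2) (by omega) (by omega)
  refine Finset.mem_biUnion.2 ⟨prime (s + 2) - prime (s + 1), hI ▸ Finset.mem_Icc.2 (by omega),
    Finset.mem_filter.2 ⟨Finset.mem_range.2 ?_, prime_prime _, ?_⟩⟩
  · have := prime_le_prime (i := s + 1) (j := N + 1) (by omega)
    omega
  · rw [Nat.add_sub_cancel' hlt.le]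
    exact prime_prime _

lemma primeCounting_prime_add_one_le (N : ℕ) :
    Nat.primeCounting (prime (N + 1) + 1) ≤ N + 2 := by
  have h1 : Nat.count Nat.Prime (prime (N + 1) + 1) = N + 1 :=
    Nat.count_nth_succ_of_infinite Nat.infinite_setOfPred_prime N
  have h2 : Nat.primeCounting (prime (N + 1) + 1) =
      Nat.count Nat.Prime (prime (N + 1) + 1 + 1) := rfl
  rw [h2, Nat.count_succ, h1]
  split_ifs <;> omega

lemma tendsto_card_smallGaps_div :
    Tendsto (fun N : ℕ => ((smallGaps N).card : ℝ) / N) atTop (𝓝 0) := by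
  have hX : Tendsto (fun N : ℕ => prime (N + 1) + 1) atTop atTop := by
    refine tendsto_atTop_mono (fun N => ?_) tendsto_id
    rcases Nat.eq_zero_or_pos N with rfl | hN
    · simp
    · have := two_mul_add_one_le_prime hN
      simp only [id]
      omega
  have hlim : Tendsto (fun x : ℕ => ∑ h ∈ Finset.Icc 1 1100,
      2 * ((pairCount h x : ℝ) * Real.log x / x)) atTop (𝓝 0) := by
    have := tendsto_finsetSum (Finset.Icc 1 1100) fun h hh =>
      (tendsto_pairCount_mul_log_div (Finset.mem_Icc.1 hh).1).const_mul 2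
    simpa using this
  refine squeeze_zero' (Eventually.of_forall fun N => by positivity) ?_ (hlim.comp hX)
  filter_upwards [hX.eventually eventually_le_primeCounting_mul_log, eventually_gt_atTop 0]
    with N hN hN0
  simp only [Function.comp]
  set x := prime (N + 1) + 1 with hx
  have hN' : (0 : ℝ) < N := by exact_mod_cast hN0
  have hx0 : (0 : ℝ) < x := by exact_mod_cast Nat.succ_pos _
  have hπ : (Nat.primeCounting x : ℝ) ≤ N + 2 := by
    exact_mod_cast primeCounting_prime_add_one_le N
  have hlx : 0 ≤ Real.log x := Real.log_natCast_nonneg x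
  have hxN : (x : ℝ) ≤ 2 * Real.log x * N := by nlinarith
  have hc : ((smallGaps N).card : ℝ) ≤ ∑ h ∈ Finset.Icc 1 1100, (pairCount h x : ℝ) := by
    exact_mod_cast card_smallGaps_le N
  have h1 : 1 / (N : ℝ) ≤ 2 * Real.log x / x := by
    rw [div_le_div_iff₀ hN' hx0]; linarith
  calc ((smallGaps N).card : ℝ) / N
      = (smallGaps N).card * (1 / (N : ℝ)) := by ring
    _ ≤ (∑ h ∈ Finset.Icc 1 1100, (pairCount h x : ℝ)) * (2 * Real.log x / x) := by gcongr
    _ = ∑ h ∈ Finset.Icc 1 1100, 2 * ((pairCount h x : ℝ) * Real.log x / x) := by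
        rw [Finset.sum_mul]
        exact Finset.sum_congr rfl fun h _ => by ring

lemma hasAsymptoticDensity_one_of_gap {A : Set ℕ}
    (hA : ∀ s, 2 ≤ s → 1100 + prime (s + 1) < prime (s + 2) → s ∈ A) :
    HasAsymptoticDensity A 1 := by
  classical
  have hlow : Tendsto (fun N : ℕ => 1 - 1 / (N : ℝ) - ((smallGaps N).card : ℝ) / N) atTop
      (𝓝 1) := by
    simpa using (tendsto_const_nhds.sub tendsto_one_div_atTop_nhds_zero_nat).sub
      tendsto_card_smallGaps_div
  refine tendsto_of_tendsto_of_tendsto_of_le_of_le' hlow tendsto_const_nhds ?_ ?_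
  · filter_upwards [eventually_gt_atTop 0] with N hN0
    have hN : (0 : ℝ) < N := by exact_mod_cast hN0
    have hsub : Finset.Icc 1 N ⊆ ((Finset.Icc 1 N).filter (· ∈ A)) ∪ ({1} ∪ smallGaps N) := by
      intro s hs
      by_cases h1 : s = 1
      · simp [h1]
      by_cases hg : prime (s + 2) ≤ 1100 + prime (s + 1)
      · simp [smallGaps, hg, Finset.mem_Icc.1 hs]
      · refine Finset.mem_union_left _ (Finset.mem_filter.2 ⟨hs, hA s ?_ (not_le.1 hg)⟩)
        have := (Finset.mem_Icc.1 hs).1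
        omega
    have h1 := (Finset.card_le_card hsub).trans (Finset.card_union_le _ _)
    have h2 := Finset.card_union_le {1} (smallGaps N)
    rw [Nat.card_Icc, Nat.add_sub_cancel] at h1
    rw [Finset.card_singleton] at h2
    have h3 : (N : ℝ) ≤ ((Finset.Icc 1 N).filter (· ∈ A)).card + (1 + (smallGaps N).card) := by
      exact_mod_cast h1.trans (Nat.add_le_add_left h2 _)
    rw [le_div_iff₀ hN]
    have h4 : (1 - 1 / (N : ℝ) - ((smallGaps N).card : ℝ) / N) * N =
        N - 1 - (smallGaps N).card := by field_simp
    rw [h4]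
    convert (show (N : ℝ) - 1 - (smallGaps N).card ≤
      ((Finset.Icc 1 N).filter (· ∈ A)).card by linarith)
  · refine Eventually.of_forall fun N => div_le_one_of_le₀ ?_ (Nat.cast_nonneg N)
    have := Finset.card_filter_le (Finset.Icc 1 N) (· ∈ A)
    rw [Nat.card_Icc, Nat.add_sub_cancel] at this
    convert (show (((Finset.Icc 1 N).filter (· ∈ A)).card : ℝ) ≤ N by exact_mod_cast this)

theorem corollary2 :
    (∀ s : ℕ, 2 ≤ s → (1100 : ℤ) < (prime (s + 2) : ℤ) - (prime (s + 1) : ℤ) →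
      IsMu s ((∑ i ∈ Finset.Icc 2 (s + 1), (prime i : ℤ)) + 1100)) ∧
    HasAsymptoticDensity
      {s : ℕ | 2 ≤ s ∧ IsMu s ((∑ i ∈ Finset.Icc 2 (s + 1), (prime i : ℤ)) + 1100)} 1 :=
  ⟨fun _ _ hgap => isMu_of_gap (by omega),
    hasAsymptoticDensity_one_of_gap fun _ hs hgap => ⟨hs, isMu_of_gap hgap⟩⟩
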